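/- Let $k$ be a field, let $\mathscr C,\mathscr D$ be $k$-linear abelian monoidal categories with $k$-bilinear tensor product, and let $F:\mathscr C\to\mathscr D$ be a $k$-linear (strong) monoidal functor. The centralizer $\mathcal Z(F)$ is the monoidal category of pairs $(U,\rho^U)$ consisting of an object $U$ of $\mathscr D$ and a natural isomorphism $\rho^U(X):U\otimes F(X)\to F(X)\otimes U$ which, modulo the isomorphisms $F(X)\otimes F(Y)\cong F(X\otimes Y)$, satisfies $\rho^U(X\otimes Y)=(F(X)\otimes\rho^U(Y))\circ(\rho^U(X)\otimes F(Y))$. Its morphisms are the morphisms of $\mathscr D$ that commute with the half-braidings; its tensor product is $U\otimes V$ with $\rho^{U\otimes V}(X)=(\rho^U(X)\otimes V)\circ(U\otimes\rho^V(X))$, and its unit is $1_{\mathscr D}$ with the canonical half-braiding. Let $(U,\rho^U,\Delta,\epsilon)$ be a coalgebra object in $\mathcal Z(F)$. (Associativity and unit isomorphisms and the isomorphisms $F(X)\otimes F(Y)\cong F(X\otimes Y)$ are suppressed.) For $n\ge 0$ let $C^n=C^n_{DY}(F,U)=\mathrm{Nat}(U\otimes F^{\otimes n},F^{\otimes n})$,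 where $F^{\otimes n}:\mathscr C^n\to\mathscr D$ is $(X_1,\dots,X_n)\mapsto F(X_1)\otimes\dots\otimes F(X_n)$; in particular $C^0=\mathrm{Hom}_{\mathscr D}(U,1)$. Let $\delta:C^n\to C^{n+1}$ be $$\delta(f)_{X_0,\dots,X_n}=(F(X_0)\otimes f_{X_1,\dots,X_n})\circ(\rho^U(X_0)\otimes F(X_1)\otimes\dots\otimes F(X_n))+\sum_{i=1}^n(-1)^if_{X_0,\dots,X_{i-1}\otimes X_i,\dots,X_n}+(-1)^{n+1}f_{X_0,\dots,X_{n-1}}\otimes F(X_n).$$ Let $\rho^U(X_1,\dots,X_n):U\otimes F(X_1)\otimes\dots\otimes F(X_n)\to F(X_1)\otimes\dots\otimes F(X_n)\otimes U$ be the composite obtained by moving $U$ successively past $F(X_1),\dots,F(X_n)$ by means of $\rho^U$. For $f\in C^m$, $g\in C^n$ define $f\cup g\in C^{m+n}$ by $$(f\cup g)_{X_1,\dots,X_{m+n}}=(f_{X_1,\dots,X_m}\otimes g_{X_{m+1},\dots,X_{m+n}})\circ(U\otimes\rho^U(X_1,\dots,X_m)\otimes F(X_{m+1})\otimes\dots\otimes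 F(X_{m+n}))\circ(\Delta\otimes F(X_1)\otimes\dots\otimes F(X_{m+n})).$$ Let $\tilde C^n\subseteq C^n$ be the subspace of those $f$ such that, for all $X_1,\dots,X_n$, $$(f_{X_1,\dots,X_n}\otimes U)\circ(U\otimes\rho^U(X_1,\dots,X_n))\circ(\Delta\otimes F(X_1)\otimes\dots\otimes F(X_n))=\rho^U(X_1,\dots,X_n)\circ(U\otimes f_{X_1,\dots,X_n})\circ(\Delta\otimes F(X_1)\otimes\dots\otimes F(X_n)).$$ Then $\delta^2=0$ and $\delta(\tilde C^n)\subseteq\tilde C^{n+1}$ for all $n$, so $\tilde C^\bullet$ is a subcomplex of $(C^\bullet,\delta)$; write $\tilde H^\bullet_{DY}(F,U)$ for its cohomology. The cup product of cocycles of $\tilde C^\bullet$ is again a cocycle of $\tilde C^\bullet$, and it induces well-defined $k$-bilinear products $\cup:\tilde H^m_{DY}(F,U)\times\tilde H^n_{DY}(F,U)\to\tilde H^{m+n}_{DY}(F,U)$. This product is graded commutative: $$\bar f\cup\bar g=(-1)^{mn}\,\bar g\cup\bar f\qquad\text{for all } m,n\ge 0,\ \bar f\in\tilde H^m_{DY}(F,U),\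 \bar g\in\tilde H^n_{DY}(F,U).$$ -/

import Mathlib

open CategoryTheory MonoidalCategory

universe v₁ v₂ u₁ u₂

namespace DavydovYetter

section Centralizer

variable {C : Type u₁} [Category.{v₁} C] [MonoidalCategory C]
variable {D : Type u₂} [Category.{v₂} D] [MonoidalCategory D]

/-- An object of the centralizer `𝒵(F)` of a monoidal functor `F : C ⥤ D`: an object `obj` of `D`
with a half-braiding relative to `F`, that is, a natural isomorphism `obj ⊗ F(-) ≅ F(-) ⊗ obj`
compatible with the structure isomorphisms `F X ⊗ F Y ≅ F (X ⊗ Y)` of `F`. -/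
structure Centralizer (F : C ⥤ D) [F.Monoidal] where
  /-- The underlying object. -/
  obj : D
  /-- The half-braiding. -/
  β : ∀ X : C, obj ⊗ F.obj X ≅ F.obj X ⊗ obj
  naturality : ∀ {X Y : C} (f : X ⟶ Y),
    obj ◁ F.map f ≫ (β Y).hom = (β X).hom ≫ F.map f ▷ obj
  monoidal : ∀ X Y : C,
    obj ◁ Functor.LaxMonoidal.μ F X Y ≫ (β (X ⊗ Y)).hom =
      (α_ _ _ _).inv ≫ (β X).hom ▷ F.obj Y ≫ (α_ _ _ _).hom ≫ F.obj X ◁ (β Y).hom ≫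
        (α_ _ _ _).inv ≫ Functor.LaxMonoidal.μ F X Y ▷ obj

namespace Centralizer

variable {F : C ⥤ D} [F.Monoidal]

/-- A morphism of the centralizer: a morphism of `D` that commutes with the half-braidings. -/
@[ext]
structure Hom (U V : Centralizer F) where
  /-- The underlying morphism. -/
  f : U.obj ⟶ V.obj
  comm : ∀ X : C, (U.β X).hom ≫ F.obj X ◁ f = f ▷ F.obj X ≫ (V.β X).hom

instance : Category (Centralizer F) where
  Hom U V := Hom U V
  id U := { f := 𝟙 U.obj, comm := fun X => by simp }
  comp a b :=
    { f := a.f ≫ b.f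
      comm := fun X => by
        rw [MonoidalCategory.whiskerLeft_comp, ← Category.assoc, a.comm, Category.assoc, b.comm,
          comp_whiskerRight, Category.assoc] }
  id_comp a := Hom.ext (Category.id_comp a.f)
  comp_id a := Hom.ext (Category.comp_id a.f)
  assoc a b c := Hom.ext (Category.assoc a.f b.f c.f)

@[ext]
theorem hom_ext {U V : Centralizer F} (a b : U ⟶ V) (h : a.f = b.f) : a = b :=
  Hom.ext h

@[simp]
theorem id_f (U : Centralizer F) : Hom.f (𝟙 U) = 𝟙 U.obj := rfl

@[simp]
theorem comp_f {U V W : Centralizer F} (a : U ⟶ V) (b : V ⟶ W) : (a ≫ b).f = a.f ≫ b.f := rfl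

/-- An isomorphism of `D` that commutes with the half-braidings is an isomorphism of the
centralizer. -/
def isoMk {U V : Centralizer F} (e : U.obj ≅ V.obj)
    (h : ∀ X : C, (U.β X).hom ≫ F.obj X ◁ e.hom = e.hom ▷ F.obj X ≫ (V.β X).hom) : U ≅ V where
  hom := ⟨e.hom, h⟩
  inv := ⟨e.inv, fun X => by
    rw [← cancel_epi (e.hom ▷ F.obj X), ← Category.assoc, ← h X]
    simp [← MonoidalCategory.whiskerLeft_comp, ← comp_whiskerRight_assoc]⟩
  hom_inv_id := Hom.ext e.hom_inv_id
  inv_hom_id := Hom.ext e.inv_hom_id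

/-- The tensor product of `(U, β)` and `(V, β')`: the object `U ⊗ V` with the half-braiding
`U ⊗ V ⊗ F X ≅ U ⊗ F X ⊗ V ≅ F X ⊗ U ⊗ V`. -/
def tensorObj (U V : Centralizer F) : Centralizer F where
  obj := U.obj ⊗ V.obj
  β X := α_ _ _ _ ≪≫ whiskerLeftIso U.obj (V.β X) ≪≫ (α_ _ _ _).symm ≪≫
    whiskerRightIso (U.β X) V.obj ≪≫ α_ _ _ _
  naturality {X Y} f := by
    simp only [Iso.trans_hom, whiskerLeftIso_hom, Iso.symm_hom, whiskerRightIso_hom]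
    calc
      _ = 𝟙 _ ⊗≫ (U.obj ◁ (V.obj ◁ F.map f ≫ (V.β Y).hom)) ⊗≫
            (U.β Y).hom ▷ V.obj ⊗≫ 𝟙 _ := by monoidal
      _ = 𝟙 _ ⊗≫ U.obj ◁ (V.β X).hom ⊗≫
            (U.obj ◁ F.map f ≫ (U.β Y).hom) ▷ V.obj ⊗≫ 𝟙 _ := by
          rw [V.naturality]; monoidal
      _ = _ := by rw [U.naturality]; monoidal
  monoidal X Y := by
    simp only [Iso.trans_hom, whiskerLeftIso_hom, Iso.symm_hom, whiskerRightIso_hom]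
    calc
      _ = 𝟙 _ ⊗≫ (U.obj ◁ (V.obj ◁ Functor.LaxMonoidal.μ F X Y ≫ (V.β (X ⊗ Y)).hom)) ⊗≫
            (U.β (X ⊗ Y)).hom ▷ V.obj ⊗≫ 𝟙 _ := by monoidal
      _ = 𝟙 _ ⊗≫ U.obj ◁ (V.β X).hom ▷ F.obj Y ⊗≫ U.obj ◁ F.obj X ◁ (V.β Y).hom ⊗≫
            (U.obj ◁ Functor.LaxMonoidal.μ F X Y ≫ (U.β (X ⊗ Y)).hom) ▷ V.obj ⊗≫ 𝟙 _ := by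
          rw [V.monoidal]; monoidal
      _ = 𝟙 _ ⊗≫ U.obj ◁ (V.β X).hom ▷ F.obj Y ⊗≫
            ((U.obj ⊗ F.obj X) ◁ (V.β Y).hom ≫ (U.β X).hom ▷ (F.obj Y ⊗ V.obj)) ⊗≫
            F.obj X ◁ (U.β Y).hom ▷ V.obj ⊗≫
            Functor.LaxMonoidal.μ F X Y ▷ (U.obj ⊗ V.obj) ⊗≫ 𝟙 _ := by
          rw [U.monoidal]; monoidal
      _ = _ := by rw [whisker_exchange]; monoidal

/-- The unit object of the centralizer: `𝟙_ D` with `𝟙_ D ⊗ F X ≅ F X ≅ F X ⊗ 𝟙_ D`. -/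
def tensorUnit (F : C ⥤ D) [F.Monoidal] : Centralizer F where
  obj := 𝟙_ D
  β X := λ_ (F.obj X) ≪≫ (ρ_ (F.obj X)).symm
  naturality f := by simp
  monoidal X Y := by
    simp only [Iso.trans_hom, Iso.symm_hom]
    monoidal

theorem whiskerLeft_comm (U : Centralizer F) {V W : Centralizer F} (a : V ⟶ W) (X : C) :
    ((tensorObj U V).β X).hom ≫ F.obj X ◁ (U.obj ◁ a.f) =
      (U.obj ◁ a.f) ▷ F.obj X ≫ ((tensorObj U W).β X).hom := by
  simp only [tensorObj, Iso.trans_hom, whiskerLeftIso_hom, Iso.symm_hom, whiskerRightIso_hom]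
  symm
  calc
    _ = 𝟙 _ ⊗≫ U.obj ◁ (a.f ▷ F.obj X ≫ (W.β X).hom) ⊗≫ (U.β X).hom ▷ W.obj ⊗≫ 𝟙 _ := by
        monoidal
    _ = 𝟙 _ ⊗≫ U.obj ◁ (V.β X).hom ⊗≫
          ((U.obj ⊗ F.obj X) ◁ a.f ≫ (U.β X).hom ▷ W.obj) ⊗≫ 𝟙 _ := by
        rw [← a.comm]; monoidal
    _ = _ := by rw [whisker_exchange]; monoidal

theorem whiskerRight_comm {U V : Centralizer F} (a : U ⟶ V) (W : Centralizer F) (X : C) :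
    ((tensorObj U W).β X).hom ≫ F.obj X ◁ (a.f ▷ W.obj) =
      (a.f ▷ W.obj) ▷ F.obj X ≫ ((tensorObj V W).β X).hom := by
  simp only [tensorObj, Iso.trans_hom, whiskerLeftIso_hom, Iso.symm_hom, whiskerRightIso_hom]
  symm
  calc
    _ = 𝟙 _ ⊗≫ (a.f ▷ (W.obj ⊗ F.obj X) ≫ V.obj ◁ (W.β X).hom) ⊗≫
          (V.β X).hom ▷ W.obj ⊗≫ 𝟙 _ := by monoidal
    _ = 𝟙 _ ⊗≫ U.obj ◁ (W.β X).hom ⊗≫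
          (a.f ▷ F.obj X ≫ (V.β X).hom) ▷ W.obj ⊗≫ 𝟙 _ := by
        rw [← whisker_exchange]; monoidal
    _ = _ := by rw [← a.comm]; monoidal

instance : MonoidalCategoryStruct (Centralizer F) where
  tensorObj U V := tensorObj U V
  whiskerLeft U _ _ a := ⟨U.obj ◁ a.f, whiskerLeft_comm U a⟩
  whiskerRight a W := ⟨a.f ▷ W.obj, whiskerRight_comm a W⟩
  tensorUnit := tensorUnit F
  associator U V W := isoMk (α_ U.obj V.obj W.obj) fun X => by
    simp only [tensorObj, Iso.trans_hom, whiskerLeftIso_hom, Iso.symm_hom, whiskerRightIso_hom]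
    monoidal
  leftUnitor U := isoMk (λ_ U.obj) fun X => by
    simp only [tensorObj, tensorUnit, Iso.trans_hom, whiskerLeftIso_hom, Iso.symm_hom,
      whiskerRightIso_hom]
    monoidal
  rightUnitor U := isoMk (ρ_ U.obj) fun X => by
    simp only [tensorObj, tensorUnit, Iso.trans_hom, whiskerLeftIso_hom, Iso.symm_hom,
      whiskerRightIso_hom]
    monoidal

theorem tensor_obj (U V : Centralizer F) : (U ⊗ V).obj = U.obj ⊗ V.obj := rfl

theorem tensor_β (U V : Centralizer F) (X : C) :
    (U ⊗ V).β X = α_ _ _ _ ≪≫ whiskerLeftIso U.obj (V.β X) ≪≫ (α_ _ _ _).symm ≪≫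
      whiskerRightIso (U.β X) V.obj ≪≫ α_ _ _ _ := rfl

theorem tensorUnit_obj : (𝟙_ (Centralizer F)).obj = 𝟙_ D := rfl

theorem tensorUnit_β (X : C) :
    (𝟙_ (Centralizer F)).β X = λ_ (F.obj X) ≪≫ (ρ_ (F.obj X)).symm := rfl

theorem whiskerLeft_f (U : Centralizer F) {V W : Centralizer F} (a : V ⟶ W) :
    (U ◁ a).f = U.obj ◁ a.f := rfl

theorem whiskerRight_f {U V : Centralizer F} (a : U ⟶ V) (W : Centralizer F) :
    (a ▷ W).f = a.f ▷ W.obj := rfl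

theorem tensorHom_f {U V W Z : Centralizer F} (a : U ⟶ V) (b : W ⟶ Z) :
    (a ⊗ₘ b).f = a.f ⊗ₘ b.f := (tensorHom_def a.f b.f).symm

instance : MonoidalCategory (Centralizer F) where
  tensorHom_def _ _ := rfl
  id_tensorHom_id U V := Hom.ext ((tensorHom_f _ _).trans (id_tensorHom_id U.obj V.obj))
  tensorHom_comp_tensorHom a b c d := Hom.ext (by
    rw [comp_f, tensorHom_f, tensorHom_f, tensorHom_f]
    exact tensorHom_comp_tensorHom a.f b.f c.f d.f)
  whiskerLeft_id U V := Hom.ext (MonoidalCategory.whiskerLeft_id U.obj V.obj)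
  id_whiskerRight U V := Hom.ext (MonoidalCategory.id_whiskerRight U.obj V.obj)
  associator_naturality a b c := Hom.ext (by
    rw [comp_f, comp_f, tensorHom_f, tensorHom_f, tensorHom_f, tensorHom_f]
    exact MonoidalCategory.associator_naturality a.f b.f c.f)
  leftUnitor_naturality a := Hom.ext (MonoidalCategory.leftUnitor_naturality a.f)
  rightUnitor_naturality a := Hom.ext (MonoidalCategory.rightUnitor_naturality a.f)
  pentagon U V W Z := Hom.ext (MonoidalCategory.pentagon U.obj V.obj W.obj Z.obj)
  triangle U V := Hom.ext (MonoidalCategory.triangle U.obj V.obj)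

end Centralizer

end Centralizer


section Tuples

variable {C : Type u₁} [Category.{v₁} C]

/-- A morphism `(X₁, …, Xₙ) ⟶ (Y₁, …, Yₙ)`: a tuple of morphisms `Xᵢ ⟶ Yᵢ`. -/
inductive HomList : List C → List C → Type (max u₁ v₁)
  | nil : HomList [] []
  | cons {X Y : C} {l l' : List C} (f : X ⟶ Y) (φ : HomList l l') : HomList (X :: l) (Y :: l')

namespace HomList

/-- The identity. -/
def id : ∀ l : List C, HomList l l
  | [] => nil
  | X :: l => cons (𝟙 X) (id l)

/-- Componentwise composition. -/
def comp : ∀ {l l' l'' : List C}, HomList l l' → HomList l' l'' → HomList l l''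
  | _, _, _, nil, nil => nil
  | _, _, _, cons f φ, cons g ψ => cons (f ≫ g) (comp φ ψ)

theorem id_comp : ∀ {l l' : List C} (φ : HomList l l'), comp (id l) φ = φ
  | _, _, nil => rfl
  | _, _, cons f φ => by simp [id, comp, id_comp φ]

theorem comp_id : ∀ {l l' : List C} (φ : HomList l l'), comp φ (id l') = φ
  | _, _, nil => rfl
  | _, _, cons f φ => by simp [id, comp, comp_id φ]

theorem assoc : ∀ {l₁ l₂ l₃ l₄ : List C} (φ : HomList l₁ l₂) (ψ : HomList l₂ l₃)
    (χ : HomList l₃ l₄), comp (comp φ ψ) χ = comp φ (comp ψ χ)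
  | _, _, _, _, nil, nil, nil => rfl
  | _, _, _, _, cons f φ, cons g ψ, cons h χ => by simp [comp, assoc φ ψ χ]

/-- The first `m` components. -/
def take : ∀ (m : ℕ) {l l' : List C}, HomList l l' → HomList (l.take m) (l'.take m)
  | 0, _, _, _ => nil
  | _ + 1, _, _, nil => nil
  | m + 1, _, _, cons f φ => cons f (take m φ)

/-- All but the first `m` components. -/
def drop : ∀ (m : ℕ) {l l' : List C}, HomList l l' → HomList (l.drop m) (l'.drop m)
  | 0, _, _, φ => φ
  | _ + 1, _, _, nil => nil
  | m + 1, _, _, cons _ φ => drop m φ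

end HomList

/-- The objects of `C × ⋯ × C` (`n` factors): tuples `(X₁, …, Xₙ)` of objects of `C`. -/
structure Tuple (C : Type u₁) (n : ℕ) where
  /-- The list `X₁, …, Xₙ`. -/
  list : List C
  length_eq : list.length = n

/-- The category `C × ⋯ × C` (`n` factors). -/
instance (n : ℕ) : Category (Tuple C n) where
  Hom X Y := HomList X.list Y.list
  id X := HomList.id X.list
  comp φ ψ := HomList.comp φ ψ
  id_comp φ := HomList.id_comp φ
  comp_id φ := HomList.comp_id φ
  assoc φ ψ χ := HomList.assoc φ ψ χ

variable [MonoidalCategory C]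

/-- Tensoring two neighbours: `(X₀, …, Xₙ) ↦ (X₀, …, Xᵢ ⊗ Xᵢ₊₁, …, Xₙ)` for `i < n` (positions are
counted from `0`; for `i ≥ n` the tuple is left unchanged, a case that is not used). -/
def contract : ℕ → List C → List C
  | 0, X :: Y :: l => (X ⊗ Y) :: l
  | i + 1, X :: l => X :: contract i l
  | _, l => l

theorem length_contract : ∀ (i : ℕ) (l : List C) (n : ℕ), i < n → l.length = n + 1 →
    (contract i l).length = n
  | 0, X :: Y :: l, n, _, h => by simpa [contract] using h
  | i + 1, X :: l, n, hi, h => by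
    obtain ⟨n, rfl⟩ : ∃ m, n = m + 1 := ⟨n - 1, by omega⟩
    simpa [contract] using length_contract i l n (by omega) (by simpa using h)
  | 0, [X], n, hi, h => by simp at h; omega
  | 0, [], n, hi, h => by simp at h
  | i + 1, [], n, hi, h => by simp at h

/-- The action of `contract` on morphisms. -/
def HomList.contract : ∀ (i : ℕ) {l l' : List C}, HomList l l' →
    HomList (DavydovYetter.contract i l) (DavydovYetter.contract i l')
  | 0, _, _, cons f (cons g φ) => cons (f ⊗ₘ g) φ
  | i + 1, _, _, cons f φ => cons f (HomList.contract i φ)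
  | 0, _, _, cons f nil => cons f nil
  | 0, _, _, nil => nil
  | _ + 1, _, _, nil => nil

end Tuples

section TensorPowers

variable {C : Type u₁} [Category.{v₁} C]
variable {D : Type u₂} [Category.{v₂} D] [MonoidalCategory D]

/-- The object `F X₁ ⊗ (F X₂ ⊗ (⋯ ⊗ (F Xₙ ⊗ 𝟙_ D)))`; it is `𝟙_ D` for the empty tuple. -/
def tensorPow (F : C ⥤ D) : List C → D
  | [] => 𝟙_ D
  | X :: l => F.obj X ⊗ tensorPow F l

/-- The morphism `F f₁ ⊗ ⋯ ⊗ F fₙ`. -/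
def tensorPowMap (F : C ⥤ D) : ∀ {l l' : List C}, HomList l l' → (tensorPow F l ⟶ tensorPow F l')
  | _, _, .nil => 𝟙 _
  | _, _, .cons f φ => F.map f ⊗ₘ tensorPowMap F φ

theorem tensorPowMap_id (F : C ⥤ D) : ∀ l : List C, tensorPowMap F (HomList.id l) = 𝟙 (tensorPow F l)
  | [] => rfl
  | X :: l => by simp [HomList.id, tensorPowMap, tensorPowMap_id F l, tensorPow]

theorem tensorPowMap_comp (F : C ⥤ D) : ∀ {l l' l'' : List C} (φ : HomList l l') (ψ : HomList l' l''),
    tensorPowMap F (HomList.comp φ ψ) = tensorPowMap F φ ≫ tensorPowMap F ψ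
  | _, _, _, .nil, .nil => (Category.id_comp _).symm
  | _, _, _, .cons f φ, .cons g ψ => by
    simp only [HomList.comp, tensorPowMap, tensorPowMap_comp F φ ψ, F.map_comp]
    exact (tensorHom_comp_tensorHom _ _ _ _).symm

/-- The functor `F^{⊗ n} : C × ⋯ × C ⥤ D`, `(X₁, …, Xₙ) ↦ F X₁ ⊗ ⋯ ⊗ F Xₙ`. -/
def tensorPowFunctor (F : C ⥤ D) (n : ℕ) : Tuple C n ⥤ D where
  obj X := tensorPow F X.list
  map φ := tensorPowMap F φ
  map_id X := tensorPowMap_id F X.list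
  map_comp φ ψ := tensorPowMap_comp F φ ψ

/-- The canonical isomorphism
`F X₁ ⊗ ⋯ ⊗ F Xₙ ≅ (F X₁ ⊗ ⋯ ⊗ F Xₘ) ⊗ (F Xₘ₊₁ ⊗ ⋯ ⊗ F Xₙ)`. -/
def tensorSplit (F : C ⥤ D) : ∀ (m : ℕ) (l : List C), tensorPow F l ≅ tensorPow F (l.take m) ⊗ tensorPow F (l.drop m)
  | 0, l => (λ_ (tensorPow F l)).symm
  | _ + 1, [] => (λ_ (𝟙_ D)).symm
  | m + 1, X :: l =>
    whiskerLeftIso (F.obj X) (tensorSplit F m l) ≪≫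
      (α_ (F.obj X) (tensorPow F (l.take m)) (tensorPow F (l.drop m))).symm

theorem tensorSplit_naturality (F : C ⥤ D) : ∀ (m : ℕ) {l l' : List C} (φ : HomList l l'),
    tensorPowMap F φ ≫ (tensorSplit F m l').hom =
      (tensorSplit F m l).hom ≫ (tensorPowMap F (φ.take m) ⊗ₘ tensorPowMap F (φ.drop m))
  | 0, l, l', φ => by
    simp only [tensorSplit, HomList.take, HomList.drop, tensorPowMap, Iso.symm_hom]
    exact (leftUnitor_inv_naturality (tensorPowMap F φ)).trans (by rw [← id_tensorHom]; rfl)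
  | _ + 1, _, _, .nil => by
    change 𝟙 (𝟙_ D) ≫ (λ_ (𝟙_ D)).inv = (λ_ (𝟙_ D)).inv ≫ (𝟙 (𝟙_ D) ⊗ₘ 𝟙 (𝟙_ D))
    rw [id_tensorHom_id, Category.comp_id, Category.id_comp]
  | m + 1, X :: l, Y :: l', .cons f φ => by
    have ih := tensorSplit_naturality F m φ
    change (F.map f ⊗ₘ tensorPowMap F φ) ≫ F.obj Y ◁ (tensorSplit F m l').hom ≫ (α_ _ _ _).inv =
      (F.obj X ◁ (tensorSplit F m l).hom ≫ (α_ _ _ _).inv) ≫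
        ((F.map f ⊗ₘ tensorPowMap F (φ.take m)) ⊗ₘ tensorPowMap F (φ.drop m))
    rw [Category.assoc, ← associator_inv_naturality, ← id_tensorHom, ← id_tensorHom,
      tensorHom_comp_tensorHom_assoc, tensorHom_comp_tensorHom_assoc, ih, Category.comp_id,
      Category.id_comp]

/-- For `i < n`, the isomorphism `F X₀ ⊗ ⋯ ⊗ F Xₙ ≅ F X₀ ⊗ ⋯ ⊗ F (Xᵢ ⊗ Xᵢ₊₁) ⊗ ⋯ ⊗ F Xₙ` given by
the monoidal structure of `F`. -/
def tensorMerge [MonoidalCategory C] (F : C ⥤ D) [F.Monoidal] :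
    ∀ (i : ℕ) (l : List C), tensorPow F l ≅ tensorPow F (contract i l)
  | 0, X :: Y :: l =>
    (α_ (F.obj X) (F.obj Y) (tensorPow F l)).symm ≪≫
      whiskerRightIso (Functor.Monoidal.μIso F X Y) (tensorPow F l)
  | i + 1, X :: l => whiskerLeftIso (F.obj X) (tensorMerge F i l)
  | 0, [_] => Iso.refl _
  | 0, [] => Iso.refl _
  | _ + 1, [] => Iso.refl _

theorem tensorMerge_naturality [MonoidalCategory C] (F : C ⥤ D) [F.Monoidal] :
    ∀ (i : ℕ) {l l' : List C} (φ : HomList l l'),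
      tensorPowMap F φ ≫ (tensorMerge F i l').hom = (tensorMerge F i l).hom ≫ tensorPowMap F (φ.contract i)
  | 0, X :: Y :: l, X' :: Y' :: l', .cons f (.cons g φ) => by
    change (F.map f ⊗ₘ (F.map g ⊗ₘ tensorPowMap F φ)) ≫ (α_ _ _ _).inv ≫
        Functor.LaxMonoidal.μ F X' Y' ▷ tensorPow F l' =
      ((α_ _ _ _).inv ≫ Functor.LaxMonoidal.μ F X Y ▷ tensorPow F l) ≫
        (F.map (f ⊗ₘ g) ⊗ₘ tensorPowMap F φ)
    rw [associator_inv_naturality_assoc, Category.assoc, ← tensorHom_id, ← tensorHom_id,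
      tensorHom_comp_tensorHom, tensorHom_comp_tensorHom, Functor.LaxMonoidal.μ_natural,
      Category.comp_id, Category.id_comp]
  | i + 1, X :: l, Y :: l', .cons f φ => by
    have ih := tensorMerge_naturality F i φ
    change (F.map f ⊗ₘ tensorPowMap F φ) ≫ F.obj Y ◁ (tensorMerge F i l').hom =
      F.obj X ◁ (tensorMerge F i l).hom ≫ (F.map f ⊗ₘ tensorPowMap F (φ.contract i))
    rw [← id_tensorHom, ← id_tensorHom, tensorHom_comp_tensorHom, tensorHom_comp_tensorHom, ih,
      Category.comp_id, Category.id_comp]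
  | 0, _, _, .cons _ .nil => (Category.comp_id _).trans (Category.id_comp _).symm
  | 0, _, _, .nil => rfl
  | _ + 1, _, _, .nil => rfl

/-- The iterated half-braiding
`U ⊗ F X₁ ⊗ ⋯ ⊗ F Xₙ ⟶ F X₁ ⊗ U ⊗ ⋯ ⊗ F Xₙ ⟶ ⋯ ⟶ F X₁ ⊗ ⋯ ⊗ F Xₙ ⊗ U`. -/
def braid [MonoidalCategory C] {F : C ⥤ D} [F.Monoidal] (U : Centralizer F) :
    ∀ l : List C, U.obj ⊗ tensorPow F l ⟶ tensorPow F l ⊗ U.obj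
  | [] => (ρ_ U.obj).hom ≫ (λ_ U.obj).inv
  | X :: l => (α_ U.obj (F.obj X) (tensorPow F l)).inv ≫ (U.β X).hom ▷ tensorPow F l ≫
      (α_ (F.obj X) U.obj (tensorPow F l)).hom ≫ F.obj X ◁ braid U l ≫
        (α_ (F.obj X) (tensorPow F l) U.obj).inv

theorem braid_naturality [MonoidalCategory C] {F : C ⥤ D} [F.Monoidal] (U : Centralizer F) :
    ∀ {l l' : List C} (φ : HomList l l'),
      U.obj ◁ tensorPowMap F φ ≫ braid U l' = braid U l ≫ tensorPowMap F φ ▷ U.obj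
  | _, _, .nil => by
    have h : tensorPowMap F (.nil : HomList ([] : List C) []) = 𝟙 (tensorPow F []) := rfl
    rw [h, MonoidalCategory.whiskerLeft_id, MonoidalCategory.id_whiskerRight, Category.id_comp,
      Category.comp_id]
  | X :: l, Y :: l', .cons f φ => by
    have ih := braid_naturality U φ
    change U.obj ◁ (F.map f ⊗ₘ tensorPowMap F φ) ≫ (α_ _ _ _).inv ≫ (U.β Y).hom ▷ tensorPow F l' ≫
        (α_ _ _ _).hom ≫ F.obj Y ◁ braid U l' ≫ (α_ _ _ _).inv =
      ((α_ _ _ _).inv ≫ (U.β X).hom ▷ tensorPow F l ≫ (α_ _ _ _).hom ≫ F.obj X ◁ braid U l ≫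
        (α_ _ _ _).inv) ≫ (F.map f ⊗ₘ tensorPowMap F φ) ▷ U.obj
    rw [MonoidalCategory.tensorHom_def]
    calc
      _ = 𝟙 _ ⊗≫ (U.obj ◁ F.map f) ▷ tensorPow F l ⊗≫
            ((U.obj ⊗ F.obj Y) ◁ tensorPowMap F φ ≫ (U.β Y).hom ▷ tensorPow F l') ⊗≫
              F.obj Y ◁ braid U l' ⊗≫ 𝟙 _ := by monoidal
      _ = 𝟙 _ ⊗≫ (U.obj ◁ F.map f ≫ (U.β Y).hom) ▷ tensorPow F l ⊗≫
              F.obj Y ◁ (U.obj ◁ tensorPowMap F φ ≫ braid U l') ⊗≫ 𝟙 _ := by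
          rw [whisker_exchange]; monoidal
      _ = 𝟙 _ ⊗≫ (U.β X).hom ▷ tensorPow F l ⊗≫
              (F.map f ▷ (U.obj ⊗ tensorPow F l) ≫ F.obj Y ◁ braid U l) ⊗≫
                F.obj Y ◁ tensorPowMap F φ ▷ U.obj ⊗≫ 𝟙 _ := by
          rw [ih, U.naturality]; monoidal
      _ = _ := by rw [← whisker_exchange]; monoidal

end TensorPowers

theorem length_take_of {A : Type*} {l : List A} {m n p : ℕ} (h : m + n = p) (hl : l.length = p) :
    (l.take m).length = m := by
  rw [List.length_take]; omega

theorem length_drop_of {A : Type*} {l : List A} {m n p : ℕ} (h : m + n = p) (hl : l.length = p) :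
    (l.drop m).length = n := by
  rw [List.length_drop]; omega

section Interchange

variable {D : Type u₂} [Category.{v₂} D] [MonoidalCategory D] {U A A' B B' : D}

theorem first_naturality (x : A ⟶ A') (y : B ⟶ B') {b : U ⊗ A ⟶ A ⊗ U} {b' : U ⊗ A' ⟶ A' ⊗ U}
    {g : U ⊗ B ⟶ B} {g' : U ⊗ B' ⟶ B'} (hb : U ◁ x ≫ b' = b ≫ x ▷ U) (hg : U ◁ y ≫ g' = g ≫ y) :
    U ◁ (x ⊗ₘ y) ≫ (α_ U A' B').inv ≫ b' ▷ B' ≫ (α_ A' U B').hom ≫ A' ◁ g' =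
      ((α_ U A B).inv ≫ b ▷ B ≫ (α_ A U B).hom ≫ A ◁ g) ≫ (x ⊗ₘ y) := by
  rw [MonoidalCategory.tensorHom_def]
  calc
    _ = 𝟙 _ ⊗≫ (U ◁ x) ▷ B ⊗≫ ((U ⊗ A') ◁ y ≫ b' ▷ B') ⊗≫ A' ◁ g' ⊗≫ 𝟙 _ := by monoidal
    _ = 𝟙 _ ⊗≫ (U ◁ x ≫ b') ▷ B ⊗≫ A' ◁ (U ◁ y ≫ g') ⊗≫ 𝟙 _ := by
      rw [whisker_exchange]; monoidal
    _ = 𝟙 _ ⊗≫ b ▷ B ⊗≫ (x ▷ (U ⊗ B) ≫ A' ◁ g) ⊗≫ A' ◁ y ⊗≫ 𝟙 _ := by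
      rw [hb, hg]; monoidal
    _ = _ := by rw [← whisker_exchange]; monoidal

theorem last_naturality (x : A ⟶ A') (y : B ⟶ B') {f : U ⊗ A ⟶ A} {f' : U ⊗ A' ⟶ A'}
    (hf : U ◁ x ≫ f' = f ≫ x) :
    U ◁ (x ⊗ₘ y) ≫ (α_ U A' B').inv ≫ f' ▷ B' = ((α_ U A B).inv ≫ f ▷ B) ≫ (x ⊗ₘ y) := by
  rw [MonoidalCategory.tensorHom_def]
  calc
    _ = 𝟙 _ ⊗≫ (U ◁ x) ▷ B ⊗≫ ((U ⊗ A') ◁ y ≫ f' ▷ B') ⊗≫ 𝟙 _ := by monoidal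
    _ = 𝟙 _ ⊗≫ (U ◁ x ≫ f') ▷ B ⊗≫ A' ◁ y ⊗≫ 𝟙 _ := by
      rw [whisker_exchange]; monoidal
    _ = _ := by rw [hf]; monoidal

theorem cup_naturality (c : U ⟶ U ⊗ U) (x : A ⟶ A') (y : B ⟶ B') {b : U ⊗ A ⟶ A ⊗ U}
    {b' : U ⊗ A' ⟶ A' ⊗ U} {f : U ⊗ A ⟶ A} {f' : U ⊗ A' ⟶ A'} {g : U ⊗ B ⟶ B}
    {g' : U ⊗ B' ⟶ B'} (hb : U ◁ x ≫ b' = b ≫ x ▷ U) (hf : U ◁ x ≫ f' = f ≫ x)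
    (hg : U ◁ y ≫ g' = g ≫ y) :
    U ◁ (x ⊗ₘ y) ≫ c ▷ (A' ⊗ B') ≫ (α_ U U (A' ⊗ B')).hom ≫
        U ◁ ((α_ U A' B').inv ≫ b' ▷ B' ≫ (α_ A' U B').hom) ≫ (α_ U A' (U ⊗ B')).inv ≫
          (f' ⊗ₘ g') =
      (c ▷ (A ⊗ B) ≫ (α_ U U (A ⊗ B)).hom ≫
        U ◁ ((α_ U A B).inv ≫ b ▷ B ≫ (α_ A U B).hom) ≫ (α_ U A (U ⊗ B)).inv ≫
          (f ⊗ₘ g)) ≫ (x ⊗ₘ y) := by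
  have key : U ◁ (x ⊗ₘ y) ≫ (α_ U A' B').inv ≫ b' ▷ B' ≫ (α_ A' U B').hom =
      ((α_ U A B).inv ≫ b ▷ B ≫ (α_ A U B).hom) ≫ (x ⊗ₘ U ◁ y) := by
    rw [MonoidalCategory.tensorHom_def, MonoidalCategory.tensorHom_def]
    calc
      _ = 𝟙 _ ⊗≫ (U ◁ x) ▷ B ⊗≫ ((U ⊗ A') ◁ y ≫ b' ▷ B') ⊗≫ 𝟙 _ := by monoidal
      _ = 𝟙 _ ⊗≫ (U ◁ x ≫ b') ▷ B ⊗≫ (A' ⊗ U) ◁ y ⊗≫ 𝟙 _ := by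
        rw [whisker_exchange]; monoidal
      _ = _ := by rw [hb]; monoidal
  rw [← Category.assoc, whisker_exchange, Category.assoc, Category.assoc,
    tensor_whiskerLeft_assoc, Iso.inv_hom_id_assoc, ← MonoidalCategory.whiskerLeft_comp_assoc,
    key, MonoidalCategory.whiskerLeft_comp_assoc, ← id_tensorHom U (x ⊗ₘ U ◁ y),
    associator_inv_naturality_assoc, tensorHom_comp_tensorHom, id_tensorHom, hf, hg]
  simp only [Category.assoc, tensorHom_comp_tensorHom]

end Interchange

section Cochains

variable {C : Type u₁} [Category.{v₁} C] [MonoidalCategory C]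
variable {D : Type u₂} [Category.{v₂} D] [MonoidalCategory D]
variable {F : C ⥤ D} [F.Monoidal]

/-- The Davydov-Yetter cochains `C^n(F, U) = Nat(U ⊗ F^{⊗ n}, F^{⊗ n})`. -/
abbrev Cochain (U : Centralizer F) (n : ℕ) : Type _ :=
  (tensorPowFunctor F n ⋙ tensorLeft U.obj) ⟶ tensorPowFunctor F n

namespace Cochain

variable {U : Centralizer F} {n : ℕ}

/-- The component `U ⊗ F X₁ ⊗ ⋯ ⊗ F Xₙ ⟶ F X₁ ⊗ ⋯ ⊗ F Xₙ` of a cochain. -/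
def component (f : Cochain U n) (l : List C) (h : l.length = n) : U.obj ⊗ tensorPow F l ⟶ tensorPow F l :=
  NatTrans.app f ⟨l, h⟩

theorem component_naturality (f : Cochain U n) {l l' : List C} (φ : HomList l l') (h : l.length = n)
    (h' : l'.length = n) : U.obj ◁ tensorPowMap F φ ≫ f.component l' h' = f.component l h ≫ tensorPowMap F φ :=
  NatTrans.naturality f (X := ⟨l, h⟩) (Y := ⟨l', h'⟩) φ

/-- A cochain from its components. -/
def of (a : ∀ l : List C, l.length = n → (U.obj ⊗ tensorPow F l ⟶ tensorPow F l))
    (ha : ∀ {l l' : List C} (φ : HomList l l') (h : l.length = n) (h' : l'.length = n),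
      U.obj ◁ tensorPowMap F φ ≫ a l' h' = a l h ≫ tensorPowMap F φ) : Cochain U n where
  app X := a X.list X.length_eq
  naturality X Y φ := ha φ X.length_eq Y.length_eq

@[ext]
theorem ext' {f g : Cochain U n} (h : ∀ l hl, f.component l hl = g.component l hl) : f = g :=
  NatTrans.ext (funext fun X => h X.list X.length_eq)

/-- The composite of a family `U ⊗ (F X₁ ⊗ ⋯ ⊗ F Xₘ) ⊗ (⋯) ⟶ (F X₁ ⊗ ⋯ ⊗ F Xₘ) ⊗ (⋯)` with the
canonical isomorphisms `tensorSplit` on both sides. -/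
def viaSplit (U : Centralizer F) (m : ℕ) (l : List C)
    (a : U.obj ⊗ (tensorPow F (l.take m) ⊗ tensorPow F (l.drop m)) ⟶
      tensorPow F (l.take m) ⊗ tensorPow F (l.drop m)) : U.obj ⊗ tensorPow F l ⟶ tensorPow F l :=
  U.obj ◁ (tensorSplit F m l).hom ≫ a ≫ (tensorSplit F m l).inv

theorem viaSplit_naturality (m : ℕ) {l l' : List C} (φ : HomList l l')
    (a : U.obj ⊗ (tensorPow F (l.take m) ⊗ tensorPow F (l.drop m)) ⟶ tensorPow F (l.take m) ⊗ tensorPow F (l.drop m))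
    (a' : U.obj ⊗ (tensorPow F (l'.take m) ⊗ tensorPow F (l'.drop m)) ⟶
      tensorPow F (l'.take m) ⊗ tensorPow F (l'.drop m))
    (h : U.obj ◁ (tensorPowMap F (φ.take m) ⊗ₘ tensorPowMap F (φ.drop m)) ≫ a' =
      a ≫ (tensorPowMap F (φ.take m) ⊗ₘ tensorPowMap F (φ.drop m))) :
    U.obj ◁ tensorPowMap F φ ≫ viaSplit U m l' a' = viaSplit U m l a ≫ tensorPowMap F φ := by
  have h₁ : (tensorSplit F m l).inv ≫ tensorPowMap F φ =
      (tensorPowMap F (φ.take m) ⊗ₘ tensorPowMap F (φ.drop m)) ≫ (tensorSplit F m l').inv := by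
    rw [Iso.inv_comp_eq, ← Category.assoc, Iso.eq_comp_inv, tensorSplit_naturality]
  rw [viaSplit, viaSplit, Category.assoc, Category.assoc, h₁, ← reassoc_of% h,
    ← MonoidalCategory.whiskerLeft_comp_assoc, tensorSplit_naturality,
    MonoidalCategory.whiskerLeft_comp_assoc]

end Cochain

open Cochain

variable (U : Centralizer F)

/-- The first term of the differential,
`(F X₀ ⊗ f_{X₁, …, Xₙ}) ∘ (ρ^U(X₀) ⊗ F X₁ ⊗ ⋯ ⊗ F Xₙ)`. -/
def dFirst {n : ℕ} (f : Cochain U n) : Cochain U (n + 1) :=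
  of (fun l hl => viaSplit U 1 l ((α_ _ _ _).inv ≫ braid U (l.take 1) ▷ tensorPow F (l.drop 1) ≫
      (α_ _ _ _).hom ≫
        tensorPow F (l.take 1) ◁ f.component (l.drop 1) (length_drop_of (Nat.add_comm 1 n) hl)))
    fun φ _ _ => viaSplit_naturality 1 φ _ _ <|
      first_naturality _ _ (braid_naturality U (φ.take 1)) (f.component_naturality (φ.drop 1) _ _)

/-- The term `f_{X₀, …, Xᵢ ⊗ Xᵢ₊₁, …, Xₙ}` of the differential, for `i = 0, …, n - 1`. -/
def dMiddle {n : ℕ} (f : Cochain U n) (i : Fin n) : Cochain U (n + 1) :=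
  of (fun l hl => U.obj ◁ (tensorMerge F i l).hom ≫
      f.component (contract i l) (length_contract i l n i.2 hl) ≫ (tensorMerge F i l).inv)
    fun {l l'} φ h h' => by
      have h₁ : (tensorMerge F i l).inv ≫ tensorPowMap F φ =
          tensorPowMap F (φ.contract i) ≫ (tensorMerge F i l').inv := by
        rw [Iso.inv_comp_eq, ← Category.assoc, Iso.eq_comp_inv, tensorMerge_naturality]
      rw [Category.assoc, Category.assoc, h₁, ← MonoidalCategory.whiskerLeft_comp_assoc,
        tensorMerge_naturality, MonoidalCategory.whiskerLeft_comp_assoc,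
        reassoc_of% f.component_naturality (φ.contract i) (length_contract i l n i.2 h)
          (length_contract i l' n i.2 h')]

/-- The last term of the differential, `f_{X₀, …, Xₙ₋₁} ⊗ F Xₙ`. -/
def dLast {n : ℕ} (f : Cochain U n) : Cochain U (n + 1) :=
  of (fun l hl => viaSplit U n l ((α_ _ _ _).inv ≫
      f.component (l.take n) (length_take_of rfl hl) ▷ tensorPow F (l.drop n)))
    fun φ _ _ => viaSplit_naturality n φ _ _ <|
      last_naturality _ _ (f.component_naturality (φ.take n) _ _)

theorem dFirst_component {n : ℕ} (f : Cochain U n) (l : List C) (hl : l.length = n + 1) :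
    (dFirst U f).component l hl = viaSplit U 1 l ((α_ _ _ _).inv ≫
      braid U (l.take 1) ▷ tensorPow F (l.drop 1) ≫ (α_ _ _ _).hom ≫
        tensorPow F (l.take 1) ◁ f.component (l.drop 1) (length_drop_of (Nat.add_comm 1 n) hl)) := rfl

theorem dMiddle_component {n : ℕ} (f : Cochain U n) (i : Fin n) (l : List C) (hl : l.length = n + 1) :
    (dMiddle U f i).component l hl = U.obj ◁ (tensorMerge F i l).hom ≫
      f.component (contract i l) (length_contract i l n i.2 hl) ≫ (tensorMerge F i l).inv := rfl

theorem dLast_component {n : ℕ} (f : Cochain U n) (l : List C) (hl : l.length = n + 1) :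
    (dLast U f).component l hl = viaSplit U n l ((α_ _ _ _).inv ≫
      f.component (l.take n) (length_take_of rfl hl) ▷ tensorPow F (l.drop n)) := rfl

/-- The comultiplication `Δ : U ⟶ U ⊗ U` of a coalgebra of the centralizer, as a morphism of
`D`. -/
def comul [ComonObj U] : U.obj ⟶ U.obj ⊗ U.obj :=
  Centralizer.Hom.f (ComonObj.comul (X := U))

/-- The cup product `f ∪ g ∈ C^p(F, U)` of `f ∈ C^m(F, U)` and `g ∈ C^n(F, U)`, where `m + n = p`:
`(f_{X₁, …, Xₘ} ⊗ g_{Xₘ₊₁, …, Xₚ}) ∘ (U ⊗ ρ^U(X₁, …, Xₘ) ⊗ F Xₘ₊₁ ⊗ ⋯) ∘ (Δ ⊗ F X₁ ⊗ ⋯)`. -/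
def cup [ComonObj U] {m n p : ℕ} (h : m + n = p) (f : Cochain U m) (g : Cochain U n) :
    Cochain U p :=
  of (fun l hl => viaSplit U m l
      (comul U ▷ (tensorPow F (l.take m) ⊗ tensorPow F (l.drop m)) ≫ (α_ _ _ _).hom ≫
        U.obj ◁ ((α_ _ _ _).inv ≫ braid U (l.take m) ▷ tensorPow F (l.drop m) ≫ (α_ _ _ _).hom) ≫
          (α_ _ _ _).inv ≫
            (f.component (l.take m) (length_take_of h hl) ⊗ₘ g.component (l.drop m) (length_drop_of h hl))))
    fun φ _ _ => viaSplit_naturality m φ _ _ <|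
      cup_naturality (comul U) _ _ (braid_naturality U (φ.take m))
        (f.component_naturality (φ.take m) _ _) (g.component_naturality (φ.drop m) _ _)

/-- `λ_L = Δ ⊗ F X₁ ⊗ ⋯ ⊗ F Xₙ`. -/
def lambdaL [ComonObj U] (l : List C) : U.obj ⊗ tensorPow F l ⟶ U.obj ⊗ (U.obj ⊗ tensorPow F l) :=
  comul U ▷ tensorPow F l ≫ (α_ _ _ _).hom

/-- `λ_R = (U ⊗ ρ^U(X₁, …, Xₙ)) ∘ (Δ ⊗ F X₁ ⊗ ⋯ ⊗ F Xₙ)`. -/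
def lambdaR [ComonObj U] (l : List C) : U.obj ⊗ tensorPow F l ⟶ (U.obj ⊗ tensorPow F l) ⊗ U.obj :=
  comul U ▷ tensorPow F l ≫ (α_ _ _ _).hom ≫ U.obj ◁ braid U l ≫ (α_ _ _ _).inv

section LinearComponents

variable {U} [Preadditive D] {n : ℕ}

theorem component_add (f g : Cochain U n) (l : List C) (hl : l.length = n) :
    (f + g).component l hl = f.component l hl + g.component l hl := rfl

theorem component_smul {k : Type*} [Field k] [Linear k D] (c : k) (f : Cochain U n) (l : List C) (hl : l.length = n) :
    (c • f).component l hl = c • f.component l hl := rfl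

theorem component_zero (l : List C) (hl : l.length = n) : (0 : Cochain U n).component l hl = 0 := rfl

end LinearComponents

section Linear

variable (k : Type*) [Field k] [Preadditive D] [MonoidalPreadditive D] [Linear k D]
  [MonoidalLinear k D]

section

variable {U} {k} {n : ℕ}

theorem dFirst_add (f g : Cochain U n) : dFirst U (f + g) = dFirst U f + dFirst U g :=
  Cochain.ext' fun l hl => by
    rw [component_add]
    simp only [dFirst_component, viaSplit, component_add, MonoidalPreadditive.whiskerLeft_add,
      Preadditive.comp_add, Preadditive.add_comp]

theorem dFirst_smul (c : k) (f : Cochain U n) : dFirst U (c • f) = c • dFirst U f :=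
  Cochain.ext' fun l hl => by
    rw [component_smul]
    simp only [dFirst_component, viaSplit, component_smul, MonoidalLinear.whiskerLeft_smul,
      Linear.comp_smul, Linear.smul_comp]

theorem dMiddle_add (f g : Cochain U n) (i : Fin n) :
    dMiddle U (f + g) i = dMiddle U f i + dMiddle U g i :=
  Cochain.ext' fun l hl => by
    rw [component_add]
    simp only [dMiddle_component, component_add, Preadditive.comp_add, Preadditive.add_comp]

theorem dMiddle_smul (c : k) (f : Cochain U n) (i : Fin n) :
    dMiddle U (c • f) i = c • dMiddle U f i :=
  Cochain.ext' fun l hl => by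
    rw [component_smul]
    simp only [dMiddle_component, component_smul, Linear.comp_smul, Linear.smul_comp]

theorem dLast_add (f g : Cochain U n) : dLast U (f + g) = dLast U f + dLast U g :=
  Cochain.ext' fun l hl => by
    rw [component_add]
    simp only [dLast_component, viaSplit, component_add, MonoidalPreadditive.add_whiskerRight,
      Preadditive.comp_add, Preadditive.add_comp]

theorem dLast_smul (c : k) (f : Cochain U n) : dLast U (c • f) = c • dLast U f :=
  Cochain.ext' fun l hl => by
    rw [component_smul]
    simp only [dLast_component, viaSplit, component_smul, MonoidalLinear.smul_whiskerRight,
      Linear.comp_smul, Linear.smul_comp]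

end

/-- The Davydov-Yetter differential
`δ f = (F X₀ ⊗ f) ∘ (ρ^U(X₀) ⊗ ⋯) + ∑_{i=1}^{n} (-1)^i f_{…, Xᵢ₋₁ ⊗ Xᵢ, …} + (-1)^{n+1} (f ⊗ F Xₙ)`. -/
def delta (n : ℕ) : Cochain U n →ₗ[k] Cochain U (n + 1) where
  toFun f := dFirst U f + ∑ i : Fin n, (-1 : k) ^ (i.val + 1) • dMiddle U f i +
    (-1 : k) ^ (n + 1) • dLast U f
  map_add' f g := by
    simp only [dFirst_add, dMiddle_add, dLast_add, smul_add, Finset.sum_add_distrib]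
    abel
  map_smul' c f := by
    simp only [dFirst_smul, dMiddle_smul, dLast_smul, smul_add, Finset.smul_sum, RingHom.id_apply,
      smul_comm c]

/-- The equivariant cochains: those `f` with
`(f_{X₁, …, Xₙ} ⊗ U) ∘ λ_R = ρ^U(X₁, …, Xₙ) ∘ (U ⊗ f_{X₁, …, Xₙ}) ∘ λ_L` for all `X₁, …, Xₙ`. -/
def equivariant [ComonObj U] (n : ℕ) : Submodule k (Cochain U n) where
  carrier := {f | ∀ (l : List C) (hl : l.length = n),
    lambdaR U l ≫ f.component l hl ▷ U.obj = lambdaL U l ≫ U.obj ◁ f.component l hl ≫ braid U l}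
  add_mem' {f g} hf hg l hl := by
    simp only [component_add, MonoidalPreadditive.whiskerLeft_add, MonoidalPreadditive.add_whiskerRight,
      Preadditive.comp_add, Preadditive.add_comp, hf l hl, hg l hl]
  zero_mem' l hl := by
    simp only [component_zero, MonoidalPreadditive.whiskerLeft_zero,
      MonoidalPreadditive.zero_whiskerRight, Limits.comp_zero, Limits.zero_comp]
  smul_mem' c f hf l hl := by
    simp only [component_smul, MonoidalLinear.whiskerLeft_smul, MonoidalLinear.smul_whiskerRight,
      Linear.comp_smul, Linear.smul_comp, hf l hl]

/-- The cocycles of degree `n` of the equivariant subcomplex. -/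
def cocycles [ComonObj U] (n : ℕ) : Submodule k (Cochain U n) :=
  equivariant U k n ⊓ LinearMap.ker (delta U k n)

/-- The coboundaries of degree `n` of the equivariant subcomplex: the images under `δ` of the
equivariant cochains of degree `n - 1`. -/
def coboundaries [ComonObj U] : ∀ n : ℕ, Submodule k (Cochain U n)
  | 0 => ⊥
  | n + 1 => (equivariant U k n).map (delta U k n)

/-- The cohomology of degree `n` of the equivariant subcomplex: cocycles modulo coboundaries. -/
abbrev Cohomology [ComonObj U] (n : ℕ) : Type _ :=
  cocycles U k n ⧸ (coboundaries U k n).submoduleOf (cocycles U k n)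

/-- The cohomology class of a cocycle. -/
def cohomologyClass [ComonObj U] (n : ℕ) : cocycles U k n →ₗ[k] Cohomology U k n :=
  Submodule.mkQ _

end Linear

end Cochains

end DavydovYetter

open DavydovYetter

set_option linter.unusedSectionVars false

/-! The cochains of all degrees are placed in one algebra. The comultiplication makes `U ⊗ -` a
comonad, and morphisms `U ⊗ A ⟶ A` are endomorphisms in its Kleisli category; their composition is
`conv`. An `n`-cochain `f` is stabilized to a family on tuples of every length by tensoring with the
remaining `F Xᵢ` on the right. After this the cofaces no longer depend on the degree: they are
operators `d₀, d₁, …` on one module with `dⱼ₊₁ dᵢ = dᵢ dⱼ` for `i ≤ j`, multiplicative for `conv`,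
and `dⱼ f = f` for `j > n`. In particular the last term of `δ` is `f` itself, seen one degree higher
(`delta_restrict`).

In this language `f ∪ g` is `f * d₀ᵐ g`, where `m` is the degree of `f` (`cup_restrict`). The
Leibniz rule is then formal (`altSum_mul`). Together with the stability of equivariance under
cofaces and products, it shows that the product descends to cohomology.

Commutativity has two sources. Equivariance of `f` is exactly the interchange law: `f` on the first
`m` factors commutes, in the Kleisli category, with any `g` on the others
(`Equivariant.interchange`). For cocycles, `f * d₀ᵐ g` and `± (d₀ⁿ f) * g` differ by the coboundary
of an explicit sum of insertions of `g` into the slots of `f`, as for Hochschild cochains; this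
needs only the cosimplicial identities and multiplicativity (`mul_sub_mul_mem`). Interchange turns
`(d₀ⁿ f) * g` into `g * d₀ⁿ f`, which is `g ∪ f`. The homotopy is a product of equivariant families,
so its coboundary lies in the equivariant subcomplex. -/

namespace DavydovYetter

/-! ### Endomorphisms in the Kleisli category of `U ⊗ -` -/

section Kleisli

variable {D : Type u₂} [Category.{v₂} D] [MonoidalCategory D] {U : D}

/-- Transport of a morphism `U ⊗ B ⟶ B` along an isomorphism `A ≅ B`. -/
def conj {A B : D} (e : A ≅ B) (f : U ⊗ B ⟶ B) : U ⊗ A ⟶ A :=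
  U ◁ e.hom ≫ f ≫ e.inv

/-- Composition in the Kleisli category of the comonad `U ⊗ -`. -/
def conv (c : U ⟶ U ⊗ U) {A : D} (f g : U ⊗ A ⟶ A) : U ⊗ A ⟶ A :=
  c ▷ A ≫ (α_ U U A).hom ≫ U ◁ g ≫ f

/-- The morphism `f ⊗ B`. -/
def tensR {A : D} (f : U ⊗ A ⟶ A) (B : D) : U ⊗ (A ⊗ B) ⟶ A ⊗ B :=
  (α_ U A B).inv ≫ f ▷ B

/-- The morphism `A ⊗ f`, after `U` has been moved past `A`. -/
def tensL {A B : D} (b : U ⊗ A ⟶ A ⊗ U) (f : U ⊗ B ⟶ B) : U ⊗ (A ⊗ B) ⟶ A ⊗ B :=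
  (α_ U A B).inv ≫ b ▷ B ≫ (α_ A U B).hom ≫ A ◁ f

/-- Moving `U` past `A` and then past `B`. -/
def braidTensor {A B : D} (b : U ⊗ A ⟶ A ⊗ U) (b' : U ⊗ B ⟶ B ⊗ U) :
    U ⊗ (A ⊗ B) ⟶ (A ⊗ B) ⊗ U :=
  (α_ U A B).inv ≫ b ▷ B ≫ (α_ A U B).hom ≫ A ◁ b' ≫ (α_ A B U).inv

/-- Compatibility of `f` with the comultiplication `c` and the braiding `b`. -/
def Equivariant (c : U ⟶ U ⊗ U) {A : D} (b : U ⊗ A ⟶ A ⊗ U) (f : U ⊗ A ⟶ A) : Prop :=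
  (c ▷ A ≫ (α_ U U A).hom ≫ U ◁ b ≫ (α_ U A U).inv) ≫ f ▷ U =
    (c ▷ A ≫ (α_ U U A).hom) ≫ U ◁ f ≫ b

variable {A B B' : D}

theorem conj_trans (e : A ≅ B) (e' : B ≅ B') (f : U ⊗ B' ⟶ B') :
    conj (e ≪≫ e') f = conj e (conj e' f) := by
  simp [conj]

theorem conj_refl (f : U ⊗ A ⟶ A) : conj (Iso.refl A) f = f := by
  simp [conj]

/-- Serves to compare components of a natural family at tuples that agree only propositionally or up
to an associator: `p` replaces a cast, and naturality of the family supplies `hf`. -/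
theorem conj_eq_conj {e : A ≅ B} {e' : A ≅ B'} {f : U ⊗ B ⟶ B} {f' : U ⊗ B' ⟶ B'}
    (p : B ⟶ B') (hf : U ◁ p ≫ f' = f ≫ p) (he : e.hom ≫ p = e'.hom) :
    conj e' f' = conj e f := by
  have h : p ≫ e'.inv = e.inv := by
    rw [← cancel_epi e.hom, reassoc_of% he]; simp
  rw [conj, conj, ← he, MonoidalCategory.whiskerLeft_comp, Category.assoc, reassoc_of% hf, h]

theorem conj_eq {e : A ≅ B} {f : U ⊗ B ⟶ B} {f' : U ⊗ A ⟶ A}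
    (h : U ◁ e.hom ≫ f = f' ≫ e.hom) : conj e f = f' := by
  rw [conj, reassoc_of% h]; simp

theorem conj_natural {A' B' : D} {e : A ≅ B} {e' : A' ≅ B'} {f : U ⊗ B ⟶ B} {f' : U ⊗ B' ⟶ B'}
    {p : A ⟶ A'} {q : B ⟶ B'} (hf : U ◁ q ≫ f' = f ≫ q) (he : p ≫ e'.hom = e.hom ≫ q) :
    U ◁ p ≫ conj e' f' = conj e f ≫ p := by
  have h : q ≫ e'.inv = e.inv ≫ p := by
    rw [← cancel_epi e.hom, ← reassoc_of% he]; simp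
  rw [conj, conj, ← MonoidalCategory.whiskerLeft_comp_assoc, he,
    MonoidalCategory.whiskerLeft_comp_assoc, reassoc_of% hf, h, Category.assoc, Category.assoc]

theorem conj_conv (c : U ⟶ U ⊗ U) (e : A ≅ B) (f g : U ⊗ B ⟶ B) :
    conj e (conv c f g) = conv c (conj e f) (conj e g) := by
  simp only [conj, conv]
  calc
    _ = (U ◁ e.hom ≫ c ▷ B) ⊗≫ U ◁ g ⊗≫ f ≫ e.inv := by monoidal
    _ = c ▷ A ⊗≫ U ◁ U ◁ e.hom ⊗≫ U ◁ (g ≫ 𝟙 _) ⊗≫ f ≫ e.inv := by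
      rw [whisker_exchange]; monoidal
    _ = _ := by rw [← e.inv_hom_id]; monoidal

theorem tensR_conv (c : U ⟶ U ⊗ U) (f g : U ⊗ A ⟶ A) (B : D) :
    tensR (conv c f g) B = conv c (tensR f B) (tensR g B) := by
  simp only [tensR, conv]; monoidal

/-- The hypothesis `hb` says that the comultiplication commutes with the braiding past `A`. Hence
splitting `U` before or after it passes `A` is the same, and `A ⊗ -` respects Kleisli composition.
-/
theorem tensL_conv {c : U ⟶ U ⊗ U} {b : U ⊗ A ⟶ A ⊗ U}
    (hb : c ▷ A ≫ (α_ U U A).hom ≫ U ◁ b ≫ (α_ U A U).inv ≫ b ▷ U ≫ (α_ A U U).hom = b ≫ A ◁ c)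
    (f g : U ⊗ B ⟶ B) : tensL b (conv c f g) = conv c (tensL b f) (tensL b g) := by
  simp only [tensL, conv]
  calc
    _ = 𝟙 _ ⊗≫ (b ≫ A ◁ c) ▷ B ⊗≫ A ◁ U ◁ g ⊗≫ A ◁ f := by monoidal
    _ = 𝟙 _ ⊗≫ c ▷ A ▷ B ⊗≫ U ◁ b ▷ B ⊗≫ (b ▷ (U ⊗ B) ≫ (A ⊗ U) ◁ g) ⊗≫ A ◁ f := by
      rw [← hb]; monoidal
    _ = _ := by rw [← whisker_exchange]; monoidal

theorem tensR_whiskerRight (e : A ≅ B) (f : U ⊗ B ⟶ B) (B' : D) :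
    conj (whiskerRightIso e B') (tensR f B') = tensR (conj e f) B' := by
  simp only [conj, tensR, whiskerRightIso_hom, whiskerRightIso_inv]; monoidal

theorem tensL_whiskerLeft (b : U ⊗ A ⟶ A ⊗ U) (e : B ≅ B') (f : U ⊗ B' ⟶ B') :
    conj (whiskerLeftIso A e) (tensL b f) = tensL b (conj e f) := by
  simp only [conj, tensL, whiskerLeftIso_hom, whiskerLeftIso_inv]
  calc
    _ = 𝟙 _ ⊗≫ ((U ⊗ A) ◁ e.hom ≫ b ▷ B') ⊗≫ A ◁ (f ≫ e.inv) := by monoidal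
    _ = _ := by rw [whisker_exchange]; monoidal

theorem tensL_whiskerRight (e : A ≅ B) {b : U ⊗ A ⟶ A ⊗ U} {b' : U ⊗ B ⟶ B ⊗ U}
    (hb : U ◁ e.hom ≫ b' = b ≫ e.hom ▷ U) (f : U ⊗ B' ⟶ B') :
    conj (whiskerRightIso e B') (tensL b' f) = tensL b f := by
  apply conj_eq
  simp only [tensL, whiskerRightIso_hom]
  calc
    _ = 𝟙 _ ⊗≫ (U ◁ e.hom ≫ b') ▷ B' ⊗≫ B ◁ f := by monoidal
    _ = 𝟙 _ ⊗≫ b ▷ B' ⊗≫ (e.hom ▷ (U ⊗ B') ≫ B ◁ f) := by rw [hb]; monoidal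
    _ = _ := by rw [← whisker_exchange]; monoidal

theorem tensR_tensR (f : U ⊗ A ⟶ A) (B B' : D) :
    conj (α_ A B B') (tensR f (B ⊗ B')) = tensR (tensR f B) B' := by
  simp only [conj, tensR]; monoidal

theorem tensR_tensL (b : U ⊗ A ⟶ A ⊗ U) (f : U ⊗ B ⟶ B) (B' : D) :
    conj (α_ A B B') (tensL b (tensR f B')) = tensR (tensL b f) B' := by
  simp only [conj, tensR, tensL]; monoidal

theorem tensL_tensL (b : U ⊗ A ⟶ A ⊗ U) (b' : U ⊗ B ⟶ B ⊗ U) (f : U ⊗ B' ⟶ B') :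
    conj (α_ A B B') (tensL b (tensL b' f)) = tensL (braidTensor b b') f := by
  simp only [conj, tensL, braidTensor]; monoidal

/-- Three copies of `U` occur: one for `g`, one for `f`, and one to be braided out. The braided copy
is moved past `g` and then past `f`; coassociativity regroups the copies so that each equivariance
hypothesis applies to two adjacent ones. -/
theorem Equivariant.conv {c : U ⟶ U ⊗ U} (hc : c ≫ U ◁ c = c ≫ c ▷ U ≫ (α_ U U U).hom)
    {b : U ⊗ A ⟶ A ⊗ U} {f g : U ⊗ A ⟶ A} (hf : Equivariant c b f) (hg : Equivariant c b g) :
    Equivariant c b (conv c f g) := by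
  simp only [Equivariant, DavydovYetter.conv] at *
  calc
    _ = c ▷ A ⊗≫ (U ◁ b ≫ c ▷ (A ⊗ U)) ⊗≫ U ◁ g ▷ U ⊗≫ f ▷ U := by monoidal
    _ = (c ≫ c ▷ U ≫ (α_ U U U).hom) ▷ A ⊗≫ U ◁ U ◁ b ⊗≫ U ◁ g ▷ U ⊗≫ f ▷ U := by
      rw [whisker_exchange]; monoidal
    _ = c ▷ A ⊗≫ U ◁ ((c ▷ A ≫ (α_ U U A).hom ≫ U ◁ b ≫ (α_ U A U).inv) ≫ g ▷ U) ⊗≫ f ▷ U := by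
      rw [← hc]; monoidal
    _ = (c ≫ U ◁ c) ▷ A ⊗≫ U ◁ U ◁ g ⊗≫ U ◁ b ⊗≫ f ▷ U := by rw [hg]; monoidal
    _ = c ▷ A ⊗≫ (c ▷ (U ⊗ A) ≫ (U ⊗ U) ◁ g) ⊗≫ U ◁ b ⊗≫ f ▷ U := by rw [hc]; monoidal
    _ = c ▷ A ⊗≫ U ◁ g ⊗≫
        ((c ▷ A ≫ (α_ U U A).hom ≫ U ◁ b ≫ (α_ U A U).inv) ≫ f ▷ U) := by
      rw [← whisker_exchange]; monoidal
    _ = c ▷ A ⊗≫ (U ◁ g ≫ c ▷ A) ⊗≫ U ◁ f ⊗≫ b := by rw [hf]; monoidal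
    _ = (c ≫ c ▷ U ≫ (α_ U U U).hom) ▷ A ⊗≫ U ◁ U ◁ g ⊗≫ U ◁ f ⊗≫ b := by
      rw [whisker_exchange]; monoidal
    _ = _ := by rw [← hc]; monoidal

theorem Equivariant.tensR {c : U ⟶ U ⊗ U} {b : U ⊗ A ⟶ A ⊗ U} (b' : U ⊗ B ⟶ B ⊗ U)
    {f : U ⊗ A ⟶ A} (hf : Equivariant c b f) :
    Equivariant c (braidTensor b b') (tensR f B) := by
  simp only [Equivariant, DavydovYetter.tensR, braidTensor] at *
  calc
    _ = 𝟙 _ ⊗≫ c ▷ A ▷ B ⊗≫ U ◁ b ▷ B ⊗≫ ((U ⊗ A) ◁ b' ≫ f ▷ (B ⊗ U)) ⊗≫ 𝟙 _ := by monoidal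
    _ = 𝟙 _ ⊗≫ ((c ▷ A ≫ (α_ U U A).hom ≫ U ◁ b ≫ (α_ U A U).inv) ≫ f ▷ U) ▷ B ⊗≫ A ◁ b'
          ⊗≫ 𝟙 _ := by rw [whisker_exchange]; monoidal
    _ = _ := by rw [hf]; monoidal

theorem Equivariant.tensL {c : U ⟶ U ⊗ U} {b : U ⊗ A ⟶ A ⊗ U}
    (hb : c ▷ A ≫ (α_ U U A).hom ≫ U ◁ b ≫ (α_ U A U).inv ≫ b ▷ U ≫ (α_ A U U).hom = b ≫ A ◁ c)
    {b' : U ⊗ B ⟶ B ⊗ U} {f : U ⊗ B ⟶ B} (hf : Equivariant c b' f) :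
    Equivariant c (braidTensor b b') (tensL b f) := by
  simp only [Equivariant, DavydovYetter.tensL, braidTensor] at *
  calc
    _ = 𝟙 _ ⊗≫ c ▷ A ▷ B ⊗≫ U ◁ b ▷ B ⊗≫ ((U ⊗ A) ◁ b' ≫ b ▷ (B ⊗ U)) ⊗≫ A ◁ f ▷ U ⊗≫ 𝟙 _ := by
      monoidal
    _ = 𝟙 _ ⊗≫ (c ▷ A ≫ (α_ U U A).hom ≫ U ◁ b ≫ (α_ U A U).inv ≫ b ▷ U ≫ (α_ A U U).hom) ▷ B
          ⊗≫ A ◁ U ◁ b' ⊗≫ A ◁ f ▷ U ⊗≫ 𝟙 _ := by rw [whisker_exchange]; monoidal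
    _ = 𝟙 _ ⊗≫ b ▷ B ⊗≫ A ◁ ((c ▷ B ≫ (α_ U U B).hom ≫ U ◁ b' ≫ (α_ U B U).inv) ≫ f ▷ U)
          ⊗≫ 𝟙 _ := by rw [hb]; monoidal
    _ = 𝟙 _ ⊗≫ (b ≫ A ◁ c) ▷ B ⊗≫ A ◁ U ◁ f ⊗≫ A ◁ b' ⊗≫ 𝟙 _ := by rw [hf]; monoidal
    _ = 𝟙 _ ⊗≫ c ▷ A ▷ B ⊗≫ U ◁ b ▷ B ⊗≫ (b ▷ (U ⊗ B) ≫ (A ⊗ U) ◁ f) ⊗≫ A ◁ b' ⊗≫ 𝟙 _ := by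
      rw [← hb]; monoidal
    _ = _ := by rw [← whisker_exchange]; monoidal

theorem Equivariant.conj {c : U ⟶ U ⊗ U} {b : U ⊗ A ⟶ A ⊗ U} {b' : U ⊗ B ⟶ B ⊗ U} (e : A ≅ B)
    (he : U ◁ e.hom ≫ b' = b ≫ e.hom ▷ U) {f : U ⊗ B ⟶ B} (hf : Equivariant c b' f) :
    Equivariant c b (conj e f) := by
  simp only [Equivariant, DavydovYetter.conj] at *
  have he' : U ◁ e.inv ≫ b = b' ≫ e.inv ▷ U := by
    rw [← cancel_epi (U ◁ e.hom), reassoc_of% he]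
    simp [← MonoidalCategory.whiskerLeft_comp_assoc, ← comp_whiskerRight]
  calc
    _ = c ▷ A ⊗≫ U ◁ (b ≫ e.hom ▷ U) ⊗≫ f ▷ U ⊗≫ e.inv ▷ U := by monoidal
    _ = (c ▷ A ≫ (U ⊗ U) ◁ e.hom) ⊗≫ U ◁ b' ⊗≫ f ▷ U ⊗≫ e.inv ▷ U := by rw [← he]; monoidal
    _ = U ◁ e.hom ⊗≫ ((c ▷ B ≫ (α_ U U B).hom ≫ U ◁ b' ≫ (α_ U B U).inv) ≫ f ▷ U) ⊗≫
        e.inv ▷ U := by rw [← whisker_exchange]; monoidal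
    _ = (U ◁ e.hom ≫ c ▷ B) ⊗≫ U ◁ f ⊗≫ (b' ≫ e.inv ▷ U) := by rw [hf]; monoidal
    _ = _ := by rw [whisker_exchange, ← he']; monoidal

/-- The interchange law holds in the Kleisli category when the left factor is equivariant. -/
theorem Equivariant.interchange {c : U ⟶ U ⊗ U} {b : U ⊗ A ⟶ A ⊗ U} {f : U ⊗ A ⟶ A}
    (hf : Equivariant c b f) (g : U ⊗ B ⟶ B) :
    DavydovYetter.conv c (DavydovYetter.tensR f B) (DavydovYetter.tensL b g) =
      DavydovYetter.conv c (DavydovYetter.tensL b g) (DavydovYetter.tensR f B) := by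
  simp only [Equivariant, DavydovYetter.conv, DavydovYetter.tensR, DavydovYetter.tensL] at *
  calc
    _ = 𝟙 _ ⊗≫ c ▷ A ▷ B ⊗≫ U ◁ b ▷ B ⊗≫ ((U ⊗ A) ◁ g ≫ f ▷ B) := by monoidal
    -- The maps `f` and `g` act on different factors, so `g` can be delayed. What precedes it is
    -- then the left side of the equivariance condition, whose right side lets `f` act before `U` is
    -- braided past `A`.
    _ = 𝟙 _ ⊗≫ ((c ▷ A ≫ (α_ U U A).hom ≫ U ◁ b ≫ (α_ U A U).inv) ≫ f ▷ U) ▷ B ⊗≫ A ◁ g := by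
      rw [whisker_exchange]; monoidal
    _ = _ := by rw [hf]; monoidal

/-- Identifies the formula defining the cup product with a Kleisli composite. -/
theorem conv_tensR_tensL (c : U ⟶ U ⊗ U) (b : U ⊗ A ⟶ A ⊗ U) (f : U ⊗ A ⟶ A) (g : U ⊗ B ⟶ B) :
    conv c (tensR f B) (tensL b g) =
      c ▷ (A ⊗ B) ≫ (α_ U U (A ⊗ B)).hom ≫ U ◁ ((α_ U A B).inv ≫ b ▷ B ≫ (α_ A U B).hom) ≫
        (α_ U A (U ⊗ B)).inv ≫ (f ⊗ₘ g) := by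
  simp only [conv, tensR, tensL, MonoidalCategory.tensorHom_def']
  monoidal

end Kleisli

/-! ### Coherence identities for merging and splitting tensor factors -/

section Coherence

variable {D : Type u₂} [Category.{v₂} D] [MonoidalCategory D]

theorem comp_eq_of_eq_id {E : Type*} [Category E] {A : E} {a b p c d : A ⟶ A} (ha : a = 𝟙 A) (hb : b = 𝟙 A) (hp : p = 𝟙 A)
    (hc : c = 𝟙 A) (hd : d = 𝟙 A) : (a ≫ b) ≫ p = c ≫ d := by
  subst ha hb hp hc hd; simp

/-- The inductive step for adding a first factor. Here and below, the whiskered map enters as a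
variable with an equation because `tensorPowMap` uses `F.map (𝟙 X)`, which is an identity only
propositionally. -/
theorem whiskerLeft_square {A B B' E E' : D} (W : D) {a : A ⟶ B} {b : B ⟶ E} {p : E ⟶ E'}
    {c : A ⟶ B'} {d : B' ⟶ E'} (h : (a ≫ b) ≫ p = c ≫ d) {q : W ⊗ E ⟶ W ⊗ E'} (hq : q = W ◁ p) :
    (W ◁ a ≫ W ◁ b) ≫ q = W ◁ c ≫ W ◁ d := by
  subst hq
  simp only [← MonoidalCategory.whiskerLeft_comp, h]

theorem merge_assoc {X Y Z A B E E' P : D} {m : X ⊗ Y ⟶ A} {m' : A ⊗ Z ⟶ E} {n : Y ⊗ Z ⟶ B}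
    {n' : X ⊗ B ⟶ E'} {r : E ⟶ E'} (h : m ▷ Z ≫ m' ≫ r = (α_ X Y Z).hom ≫ X ◁ n ≫ n')
    {q : E ⊗ P ⟶ E' ⊗ P} (hq : q = r ▷ P) :
    (((α_ X Y (Z ⊗ P)).inv ≫ m ▷ (Z ⊗ P)) ≫ (α_ A Z P).inv ≫ m' ▷ P) ≫ q =
      X ◁ ((α_ Y Z P).inv ≫ n ▷ P) ≫ (α_ X B P).inv ≫ n' ▷ P := by
  subst hq
  calc
    _ = 𝟙 _ ⊗≫ (m ▷ Z ≫ m' ≫ r) ▷ P := by monoidal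
    _ = _ := by rw [h]; monoidal

theorem merge_exchange {X Y A P P' : D} (m : X ⊗ Y ⟶ A) (e : P ⟶ P') {q : A ⊗ P' ⟶ A ⊗ P'}
    (hq : q = 𝟙 _) :
    (((α_ X Y P).inv ≫ m ▷ P) ≫ A ◁ e) ≫ q = X ◁ Y ◁ e ≫ (α_ X Y P').inv ≫ m ▷ P' := by
  subst hq
  rw [Category.comp_id, Category.assoc, ← whisker_exchange]
  monoidal

theorem braidTensor_merge {U X Y A P : D} {m : X ⊗ Y ⟶ A} {x : U ⊗ X ⟶ X ⊗ U}
    {y : U ⊗ Y ⟶ Y ⊗ U} {a : U ⊗ A ⟶ A ⊗ U} (b : U ⊗ P ⟶ P ⊗ U)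
    (h : U ◁ m ≫ a = (α_ _ _ _).inv ≫ x ▷ Y ≫ (α_ _ _ _).hom ≫ X ◁ y ≫ (α_ _ _ _).inv ≫ m ▷ U) :
    U ◁ ((α_ X Y P).inv ≫ m ▷ P) ≫ braidTensor a b =
      braidTensor x (braidTensor y b) ≫ ((α_ X Y P).inv ≫ m ▷ P) ▷ U := by
  simp only [braidTensor]
  calc
    _ = 𝟙 _ ⊗≫ (U ◁ m ≫ a) ▷ P ⊗≫ A ◁ b ⊗≫ 𝟙 _ := by monoidal
    _ = 𝟙 _ ⊗≫ x ▷ Y ▷ P ⊗≫ X ◁ y ▷ P ⊗≫ (m ▷ (U ⊗ P) ≫ A ◁ b) ⊗≫ 𝟙 _ := by rw [h]; monoidal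
    _ = _ := by rw [← whisker_exchange]; monoidal

theorem braidTensor_whiskerLeft {U X P P' : D} (x : U ⊗ X ⟶ X ⊗ U) {e : P ⟶ P'}
    {b : U ⊗ P ⟶ P ⊗ U} {b' : U ⊗ P' ⟶ P' ⊗ U} (h : U ◁ e ≫ b' = b ≫ e ▷ U) :
    U ◁ (X ◁ e) ≫ braidTensor x b' = braidTensor x b ≫ (X ◁ e) ▷ U := by
  simp only [braidTensor]
  calc
    _ = 𝟙 _ ⊗≫ ((U ⊗ X) ◁ e ≫ x ▷ P') ⊗≫ X ◁ b' ⊗≫ 𝟙 _ := by monoidal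
    _ = 𝟙 _ ⊗≫ x ▷ P ⊗≫ X ◁ (U ◁ e ≫ b') ⊗≫ 𝟙 _ := by rw [whisker_exchange]; monoidal
    _ = _ := by rw [h]; monoidal

theorem braidTensor_unit {U P : D} (b : U ⊗ P ⟶ P ⊗ U) :
    U ◁ (λ_ P).inv ≫ braidTensor ((ρ_ U).hom ≫ (λ_ U).inv) b = b ≫ (λ_ P).inv ▷ U := by
  simp only [braidTensor]; monoidal

theorem braidTensor_assoc {U X P A B : D} (x : U ⊗ X ⟶ X ⊗ U) {e : P ⟶ A ⊗ B}
    {a : U ⊗ A ⟶ A ⊗ U} {b : U ⊗ B ⟶ B ⊗ U} {c : U ⊗ P ⟶ P ⊗ U}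
    (h : U ◁ e ≫ braidTensor a b = c ≫ e ▷ U) :
    U ◁ (X ◁ e ≫ (α_ X A B).inv) ≫ braidTensor (braidTensor x a) b =
      braidTensor x c ≫ (X ◁ e ≫ (α_ X A B).inv) ▷ U := by
  have h' := braidTensor_whiskerLeft x h
  rw [comp_whiskerRight, ← reassoc_of% h']
  simp only [braidTensor]
  monoidal

theorem split_cons {P A B P' A' B' : D} (X : D) {s : P ⟶ A ⊗ B} {s' : P' ⟶ A' ⊗ B'} {p : A ⟶ A'}
    {q : B ⟶ B'} {m : P ⟶ P'} (h : s ≫ (p ⊗ₘ q) = m ≫ s') {p' : X ⊗ A ⟶ X ⊗ A'}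
    (hp : p' = X ◁ p) :
    (X ◁ s ≫ (α_ X A B).inv) ≫ (p' ⊗ₘ q) = X ◁ m ≫ X ◁ s' ≫ (α_ X A' B').inv := by
  subst hp
  rw [← MonoidalCategory.whiskerLeft_comp_assoc, ← h]
  simp only [MonoidalCategory.tensorHom_def]
  monoidal

theorem split_merge_cons {P A A₀ B P' A' B' : D} (X : D) {s : P ⟶ A₀ ⊗ B} {a : A₀ ⟶ A}
    {s' : P' ⟶ A' ⊗ B'} {p : A ⟶ A'}
    {q : B ⟶ B'} {m : P ⟶ P'} (h : (s ≫ a ▷ B) ≫ (p ⊗ₘ q) = m ≫ s') {p' : X ⊗ A ⟶ X ⊗ A'}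
    (hp : p' = X ◁ p) :
    ((X ◁ s ≫ (α_ X A₀ B).inv) ≫ (X ◁ a) ▷ B) ≫ (p' ⊗ₘ q) =
      X ◁ m ≫ X ◁ s' ≫ (α_ X A' B').inv := by
  rw [← split_cons X h hp]
  simp only [Category.assoc, MonoidalCategory.whiskerLeft_comp]
  simp

theorem split_merge_zero {X Y Z P A B : D} (m : X ⊗ Y ⟶ Z) (s : P ⟶ A ⊗ B)
    {p : Z ⊗ A ⟶ Z ⊗ A} (hp : p = 𝟙 _) :
    ((X ◁ (Y ◁ s ≫ (α_ Y A B).inv) ≫ (α_ X (Y ⊗ A) B).inv) ≫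
        ((α_ X Y A).inv ≫ m ▷ A) ▷ B) ≫ (p ⊗ₘ 𝟙 B) =
      ((α_ X Y P).inv ≫ m ▷ P) ≫ Z ◁ s ≫ (α_ Z A B).inv := by
  subst hp
  rw [id_tensorHom_id, Category.comp_id, Category.assoc _ (m ▷ P), ← whisker_exchange_assoc]
  monoidal

theorem split_split_cons {P A B A' A'' E E' : D} (X : D) {s : P ⟶ A ⊗ B} {t : A ⟶ A' ⊗ E}
    {p : A' ⟶ A''} {q : E ⊗ B ⟶ E'} {s' : P ⟶ A'' ⊗ E'}
    (h : (s ≫ t ▷ B ≫ (α_ _ _ _).hom) ≫ (p ⊗ₘ q) = s') {p' : X ⊗ A' ⟶ X ⊗ A''}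
    (hp : p' = X ◁ p) :
    ((X ◁ s ≫ (α_ X A B).inv) ≫ (X ◁ t ≫ (α_ X A' E).inv) ▷ B ≫ (α_ _ _ _).hom) ≫
      (p' ⊗ₘ q) = X ◁ s' ≫ (α_ X A'' E').inv := by
  subst hp h
  simp only [MonoidalCategory.tensorHom_def]
  monoidal

theorem split_rightUnitor_cons {P A B : D} (X : D) {s : P ⟶ A ⊗ B} {p : A ⟶ P} {q : B ⟶ 𝟙_ D}
    (h : s ≫ (p ⊗ₘ q) = (ρ_ P).inv) {p' : X ⊗ A ⟶ X ⊗ P} (hp : p' = X ◁ p) :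
    (X ◁ s ≫ (α_ X A B).inv) ≫ (p' ⊗ₘ q) = (ρ_ (X ⊗ P)).inv := by
  have h' : (ρ_ (X ⊗ P)).inv = X ◁ (ρ_ P).inv ≫ (α_ _ _ _).inv := by monoidal
  subst hp
  rw [h', ← h]
  simp only [MonoidalCategory.tensorHom_def]
  monoidal

end Coherence

/-! ### Splitting, merging and braiding of tensor powers along lists -/

section Lists

variable {C : Type u₁} [Category.{v₁} C]
variable {D : Type u₂} [Category.{v₂} D] [MonoidalCategory D]

theorem HomList.length_eq : ∀ {l l' : List C}, HomList l l' → l.length = l'.length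
  | _, _, .nil => rfl
  | _, _, .cons _ φ => congrArg (· + 1) (HomList.length_eq φ)

theorem tensorPowMap_cons_id (F : C ⥤ D) (X : C) {l l' : List C} (φ : HomList l l') :
    tensorPowMap F (.cons (𝟙 X) φ) = F.obj X ◁ tensorPowMap F φ := by
  simp [tensorPowMap, tensorPow]

/-- Splitting a tensor power at two positions. -/
theorem split_take (F : C ⥤ D) : ∀ {n m : ℕ}, n ≤ m → ∀ l : List C,
    ∃ (φ : HomList ((l.take m).take n) (l.take n))
      (q : tensorPow F ((l.take m).drop n) ⊗ tensorPow F (l.drop m) ⟶ tensorPow F (l.drop n)),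
      ((tensorSplit F m l).hom ≫ (tensorSplit F n (l.take m)).hom ▷ tensorPow F (l.drop m) ≫
        (α_ _ _ _).hom) ≫ (tensorPowMap F φ ⊗ₘ q) = (tensorSplit F n l).hom
  | 0, m, _, l => by
    refine ⟨.nil, (tensorSplit F m l).inv, ?_⟩
    change ((tensorSplit F m l).hom ≫ (λ_ (tensorPow F (l.take m))).inv ▷ _ ≫
      (α_ _ _ _).hom) ≫ (𝟙 (𝟙_ D) ⊗ₘ (tensorSplit F m l).inv) = (λ_ (tensorPow F l)).inv
    simp
  | n + 1, m + 1, _, [] => by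
    refine ⟨.nil, (λ_ (𝟙_ D)).hom, ?_⟩
    change ((λ_ (𝟙_ D)).inv ≫ (λ_ (𝟙_ D)).inv ▷ 𝟙_ D ≫ (α_ _ _ _).hom) ≫
      (𝟙 (𝟙_ D) ⊗ₘ (λ_ (𝟙_ D)).hom) = (λ_ (𝟙_ D)).inv
    rw [id_tensorHom]; monoidal
  | n + 1, m + 1, h, X :: l => by
    obtain ⟨φ, q, hφ⟩ := split_take F (Nat.le_of_succ_le_succ h) l
    exact ⟨.cons (𝟙 X) φ, q, split_split_cons (F.obj X) hφ (tensorPowMap_cons_id F X φ)⟩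

theorem split_of_length_le (F : C ⥤ D) : ∀ {n : ℕ} (l : List C), l.length ≤ n →
    ∃ (φ : HomList (l.take n) l) (q : tensorPow F (l.drop n) ⟶ 𝟙_ D),
      (tensorSplit F n l).hom ≫ (tensorPowMap F φ ⊗ₘ q) = (ρ_ (tensorPow F l)).inv
  | 0, [], _ => ⟨.nil, 𝟙 (𝟙_ D), by
      change (λ_ (𝟙_ D)).inv ≫ (𝟙 (𝟙_ D) ⊗ₘ 𝟙 (𝟙_ D)) = (ρ_ (𝟙_ D)).inv
      rw [id_tensorHom_id]; monoidal⟩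
  | n + 1, [], _ => ⟨.nil, 𝟙 (𝟙_ D), by
      change (λ_ (𝟙_ D)).inv ≫ (𝟙 (𝟙_ D) ⊗ₘ 𝟙 (𝟙_ D)) = (ρ_ (𝟙_ D)).inv
      rw [id_tensorHom_id]; monoidal⟩
  | n + 1, X :: l, h => by
    obtain ⟨φ, q, hφ⟩ := split_of_length_le F l (Nat.le_of_succ_le_succ h)
    exact ⟨.cons (𝟙 X) φ, q, split_rightUnitor_cons (F.obj X) hφ (tensorPowMap_cons_id F X φ)⟩

variable [MonoidalCategory C]

/-- For `i < j` the two contractions touch disjoint pairs and `φ` consists of identities. For `i =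
j` three neighbours are merged in two ways and `φ` contains their associator; this is the
associativity axiom of the monoidal functor. -/
theorem contract_comm (F : C ⥤ D) [F.Monoidal] : ∀ {i j : ℕ}, i ≤ j → ∀ l : List C,
    ∃ φ : HomList (contract j (contract i l)) (contract i (contract (j + 1) l)),
      ((tensorMerge F i l).hom ≫ (tensorMerge F j (contract i l)).hom) ≫ tensorPowMap F φ =
        (tensorMerge F (j + 1) l).hom ≫ (tensorMerge F i (contract (j + 1) l)).hom
  | i + 1, j + 1, h, X :: l => by
    obtain ⟨φ, hφ⟩ := contract_comm F (Nat.le_of_succ_le_succ h) l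
    exact ⟨.cons (𝟙 X) φ, whiskerLeft_square _ hφ (tensorPowMap_cons_id F X φ)⟩
  | i + 1, j + 1, _, [] => ⟨.nil, comp_eq_of_eq_id (A := 𝟙_ D) rfl rfl rfl rfl rfl⟩
  | 0, 0, _, [] => ⟨.nil, comp_eq_of_eq_id (A := 𝟙_ D) rfl rfl rfl rfl rfl⟩
  | 0, 0, _, [X] => ⟨.id [X], comp_eq_of_eq_id (A := F.obj X ⊗ 𝟙_ D) rfl rfl
      (tensorPowMap_id F [X]) (MonoidalCategory.whiskerLeft_id _ _) rfl⟩
  -- Only one merge is possible, so the other contraction on each side is the default identity; the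
  -- exchange law is used with `e = 𝟙`.
  | 0, 0, _, [X, Y] => ⟨.id [X ⊗ Y], merge_exchange (P := 𝟙_ D) (P' := 𝟙_ D)
      (Functor.LaxMonoidal.μ F X Y) (𝟙 _) (tensorPowMap_id F [X ⊗ Y]) |> fun h => by
        refine Eq.trans ?_ (h.trans ?_)
        · exact congrArg (fun t => (_ ≫ t) ≫ _) (MonoidalCategory.whiskerLeft_id _ _).symm
        · exact congrArg (fun t => F.obj X ◁ t ≫ _) (MonoidalCategory.whiskerLeft_id _ _)⟩
  | 0, 0, _, X :: Y :: Z :: l => ⟨.cons (α_ X Y Z).hom (.id l),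
      merge_assoc (Functor.LaxMonoidal.associativity (F := F) X Y Z) (by
        simp [tensorPowMap, tensorPowMap_id])⟩
  | 0, j + 1, _, [] => ⟨.nil, comp_eq_of_eq_id (A := 𝟙_ D) rfl rfl rfl rfl rfl⟩
  | 0, 1, _, [X] => ⟨.id [X], comp_eq_of_eq_id (A := F.obj X ⊗ 𝟙_ D) rfl
      (MonoidalCategory.whiskerLeft_id _ _)
      (tensorPowMap_id F [X]) (MonoidalCategory.whiskerLeft_id _ _) rfl⟩
  | 0, j + 2, _, [X] => ⟨.id [X], comp_eq_of_eq_id (A := F.obj X ⊗ 𝟙_ D) rfl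
      (MonoidalCategory.whiskerLeft_id _ _)
      (tensorPowMap_id F [X]) (MonoidalCategory.whiskerLeft_id _ _) rfl⟩
  | 0, j + 1, _, X :: Y :: l => ⟨.id _, merge_exchange (Functor.LaxMonoidal.μ F X Y)
      (tensorMerge F j l).hom (tensorPowMap_id F (X ⊗ Y :: contract j l))⟩

/-- The hexagon axiom of the half-braiding, applied at the merged pair. -/
theorem braid_merge {F : C ⥤ D} [F.Monoidal] (U : Centralizer F) : ∀ (i : ℕ) (l : List C),
    U.obj ◁ (tensorMerge F i l).hom ≫ braid U (contract i l) =
      braid U l ≫ (tensorMerge F i l).hom ▷ U.obj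
  | 0, X :: Y :: l => braidTensor_merge (braid U l) (U.monoidal X Y)
  | i + 1, X :: l => braidTensor_whiskerLeft (U.β X).hom (braid_merge U i l)
  | 0, [X] => by
    change _ ◁ 𝟙 _ ≫ braid U [X] = braid U [X] ≫ 𝟙 _ ▷ _
    simp
  | 0, [] => by
    change _ ◁ 𝟙 _ ≫ braid U [] = braid U [] ≫ 𝟙 _ ▷ _
    simp
  | i + 1, [] => by
    change _ ◁ 𝟙 _ ≫ braid U [] = braid U [] ≫ 𝟙 _ ▷ _
    simp

theorem braid_split {F : C ⥤ D} [F.Monoidal] (U : Centralizer F) : ∀ (n : ℕ) (l : List C),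
    U.obj ◁ (tensorSplit F n l).hom ≫ braidTensor (braid U (l.take n)) (braid U (l.drop n)) =
      braid U l ≫ (tensorSplit F n l).hom ▷ U.obj
  | 0, l => braidTensor_unit (braid U l)
  | _ + 1, [] => braidTensor_unit (braid U [])
  | n + 1, X :: l => braidTensor_assoc (U.β X).hom (braid_split U n l)

/-- The merged pair lies wholly in the second block, so the first block changes only by identities.
-/
theorem split_contract_of_le (F : C ⥤ D) [F.Monoidal] : ∀ {n j : ℕ}, n ≤ j → ∀ l : List C,
    ∃ (φ : HomList (l.take n) ((contract j l).take n))
      (q : tensorPow F (l.drop n) ⟶ tensorPow F ((contract j l).drop n)),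
      (tensorSplit F n l).hom ≫ (tensorPowMap F φ ⊗ₘ q) =
        (tensorMerge F j l).hom ≫ (tensorSplit F n (contract j l)).hom
  | 0, j, _, l => ⟨.nil, (tensorMerge F j l).hom, by
      exact (congrArg ((λ_ _).inv ≫ ·) (id_tensorHom _ _)).trans
        (leftUnitor_inv_naturality (tensorMerge F j l).hom).symm⟩
  | n + 1, j + 1, _, [] => ⟨.nil, 𝟙 (𝟙_ D), by
      change (λ_ (𝟙_ D)).inv ≫ (𝟙 (𝟙_ D) ⊗ₘ 𝟙 (𝟙_ D)) = 𝟙 (𝟙_ D) ≫ (λ_ (𝟙_ D)).inv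
      simp⟩
  | n + 1, j + 1, h, X :: l => by
    obtain ⟨φ, q, hφ⟩ := split_contract_of_le F (Nat.le_of_succ_le_succ h) l
    exact ⟨.cons (𝟙 X) φ, q, split_cons (F.obj X) hφ (tensorPowMap_cons_id F X φ)⟩

/-- The merged pair lies wholly among the first `n + 1` entries, which become the first `n` after
contraction. -/
theorem split_contract_of_lt (F : C ⥤ D) [F.Monoidal] : ∀ {j n : ℕ}, j < n → ∀ l : List C,
    ∃ (φ : HomList (contract j (l.take (n + 1))) ((contract j l).take n))
      (q : tensorPow F (l.drop (n + 1)) ⟶ tensorPow F ((contract j l).drop n)),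
      ((tensorSplit F (n + 1) l).hom ≫
        (tensorMerge F j (l.take (n + 1))).hom ▷ tensorPow F (l.drop (n + 1))) ≫
          (tensorPowMap F φ ⊗ₘ q) =
        (tensorMerge F j l).hom ≫ (tensorSplit F n (contract j l)).hom
  | 0, n + 1, _, [] => ⟨.nil, 𝟙 (𝟙_ D), by
      change ((λ_ (𝟙_ D)).inv ≫ 𝟙 (𝟙_ D) ▷ 𝟙_ D) ≫ (𝟙 (𝟙_ D) ⊗ₘ 𝟙 (𝟙_ D)) =
        𝟙 (𝟙_ D) ≫ (λ_ (𝟙_ D)).inv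
      simp⟩
  | 0, 1, _, [X] => ⟨.id [X], 𝟙 (𝟙_ D), by
      refine (congrArg (fun t => _ ≫ (t ⊗ₘ 𝟙 (𝟙_ D))) (tensorPowMap_id F [X])).trans ?_
      change ((F.obj X ◁ (λ_ (𝟙_ D)).inv ≫ (α_ _ _ _).inv) ≫ 𝟙 (F.obj X ⊗ 𝟙_ D) ▷ 𝟙_ D) ≫
        (𝟙 (F.obj X ⊗ 𝟙_ D) ⊗ₘ 𝟙 (𝟙_ D)) =
          𝟙 (F.obj X ⊗ 𝟙_ D) ≫ F.obj X ◁ (λ_ (𝟙_ D)).inv ≫ (α_ _ _ _).inv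
      simp⟩
  | 0, n + 2, _, [X] => ⟨.id [X], 𝟙 (𝟙_ D), by
      refine (congrArg (fun t => _ ≫ (t ⊗ₘ 𝟙 (𝟙_ D))) (tensorPowMap_id F [X])).trans ?_
      change ((F.obj X ◁ (λ_ (𝟙_ D)).inv ≫ (α_ _ _ _).inv) ≫ 𝟙 (F.obj X ⊗ 𝟙_ D) ▷ 𝟙_ D) ≫
        (𝟙 (F.obj X ⊗ 𝟙_ D) ⊗ₘ 𝟙 (𝟙_ D)) =
          𝟙 (F.obj X ⊗ 𝟙_ D) ≫ F.obj X ◁ (λ_ (𝟙_ D)).inv ≫ (α_ _ _ _).inv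
      simp⟩
  | 0, n + 1, _, X :: Y :: l => ⟨.id _, 𝟙 _, split_merge_zero (Functor.LaxMonoidal.μ F X Y)
      (tensorSplit F n l).hom (tensorPowMap_id F (X ⊗ Y :: l.take n))⟩
  | j + 1, n + 1, _, [] => ⟨.nil, 𝟙 (𝟙_ D), by
      change ((λ_ (𝟙_ D)).inv ≫ 𝟙 (𝟙_ D) ▷ 𝟙_ D) ≫ (𝟙 (𝟙_ D) ⊗ₘ 𝟙 (𝟙_ D)) =
        𝟙 (𝟙_ D) ≫ (λ_ (𝟙_ D)).inv
      simp⟩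
  | j + 1, n + 1, h, X :: l => by
    obtain ⟨φ, q, hφ⟩ := split_contract_of_lt F (Nat.lt_of_succ_lt_succ h) l
    exact ⟨.cons (𝟙 X) φ, q, split_merge_cons (F.obj X) hφ (tensorPowMap_cons_id F X φ)⟩

end Lists

/-! ### Cofaces, padding, shifts and products of families -/

section FamilyOperations

variable {C : Type u₁} [Category.{v₁} C] [MonoidalCategory C]
variable {D : Type u₂} [Category.{v₂} D] [MonoidalCategory D]
variable {F : C ⥤ D} [F.Monoidal]

/-- A family of morphisms `U ⊗ F X₁ ⊗ ⋯ ⊗ F Xₙ ⟶ F X₁ ⊗ ⋯ ⊗ F Xₙ`, for tuples of all lengths. -/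
abbrev Family (U : Centralizer F) : Type _ :=
  ∀ l : List C, U.obj ⊗ tensorPow F l ⟶ tensorPow F l

variable (U : Centralizer F)

/-- A family is natural if it is natural in each length. -/
def IsNatural (f : Family U) : Prop :=
  ∀ {l l' : List C} (φ : HomList l l'),
    U.obj ◁ tensorPowMap F φ ≫ f l' = f l ≫ tensorPowMap F φ

namespace Family

variable {U}

/-- The operators `f ↦ F X₀ ⊗ f` (for `0`) and `f ↦ f_{…, Xⱼ ⊗ Xⱼ₊₁, …}` (for `j + 1`). -/
def coface : ℕ → Family U → Family U
  | 0, f, [] => f []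
  | 0, f, X :: l => tensL (U.β X).hom (f l)
  | j + 1, f, l => conj (tensorMerge F j l) (f (contract j l))

/-- The family `f_{X₁, …, Xₙ} ⊗ F Xₙ₊₁ ⊗ ⋯`. -/
def pad (n : ℕ) (f : Family U) : Family U := fun l =>
  conj (tensorSplit F n l) (tensR (f (l.take n)) (tensorPow F (l.drop n)))

/-- The family `F X₁ ⊗ ⋯ ⊗ F Xₘ ⊗ f_{Xₘ₊₁, …}`. -/
def shift (m : ℕ) (f : Family U) : Family U := fun l =>
  conj (tensorSplit F m l) (tensL (braid U (l.take m)) (f (l.drop m)))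

variable {f g : Family U}

theorem coface_nil (j : ℕ) (f : Family U) : coface j f [] = f [] := by
  match j with
  | 0 => rfl
  | 1 => exact conj_refl (A := 𝟙_ D) (f [])
  | j + 2 => exact conj_refl (A := 𝟙_ D) (f [])

theorem shift_zero (f : Family U) : shift 0 f = f := by
  funext l
  change conj (λ_ _).symm (tensL ((ρ_ U.obj).hom ≫ (λ_ U.obj).inv) (f l)) = f l
  simp only [conj, tensL, Iso.symm_hom, Iso.symm_inv]
  monoidal

/-- Makes shifting by `m` the `m`-th power of the zeroth coface, so that the cup product can be
written with cofaces alone. -/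
theorem shift_succ (m : ℕ) (f : Family U) : shift (m + 1) f = coface 0 (shift m f) := by
  funext l
  match l with
  | [] =>
    change shift 0 f [] = shift m f []
    cases m <;> rfl
  | X :: l =>
    change conj (whiskerLeftIso _ _ ≪≫ (α_ _ _ _).symm) (tensL (braidTensor _ _) (f (l.drop m))) =
      tensL (U.β X).hom (conj _ _)
    rw [← tensL_tensL, conj_trans, ← conj_trans (α_ _ _ _).symm, Iso.symm_self_id, conj_refl,
      tensL_whiskerLeft]

/-- The cosimplicial identities. They hold as equalities, for all tuple lengths at once, because
naturality of `f` absorbs the associators left by repeated contraction. -/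
theorem coface_comm (hf : IsNatural U f) {i j : ℕ} (h : i ≤ j) :
    coface (j + 1) (coface i f) = coface i (coface j f) := by
  funext l
  match i, j, l with
  | 0, j, [] => simp only [coface_nil]
  | 0, 0, [X] => exact conj_refl (A := F.obj X ⊗ 𝟙_ D) (tensL (U.β X).hom (f []))
  -- The only case that involves both the braiding and a merge: it is the hexagon axiom for `X ⊗ Y`.
  | 0, 0, X :: Y :: l =>
    change conj ((α_ _ _ _).symm ≪≫ whiskerRightIso (Functor.Monoidal.μIso F X Y) _)
      (tensL (U.β (X ⊗ Y)).hom (f l)) = tensL (U.β X).hom (tensL (U.β Y).hom (f l))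
    rw [conj_trans, tensL_whiskerRight (b := braidTensor (U.β X).hom (U.β Y).hom), ← tensL_tensL,
      ← conj_trans, Iso.symm_self_id, conj_refl]
    simpa [braidTensor] using U.monoidal X Y
  | 0, j + 1, X :: l => exact tensL_whiskerLeft (U.β X).hom (tensorMerge F j l) _
  | i + 1, j + 1, l =>
    obtain ⟨φ, hφ⟩ := contract_comm F (Nat.le_of_succ_le_succ h) l
    change conj _ (conj _ _) = conj _ (conj _ _)
    rw [← conj_trans, ← conj_trans]
    exact conj_eq_conj _ (hf φ) hφ

theorem pad_of_length_le (hf : IsNatural U f) {n : ℕ} (l : List C) (hl : l.length ≤ n) :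
    pad n f l = f l := by
  obtain ⟨φ, q, h⟩ := split_of_length_le F l hl
  have h₁ : conj (ρ_ _).symm (tensR (f l) (𝟙_ D)) = f l := by
    simp only [conj, tensR, Iso.symm_hom, Iso.symm_inv]; monoidal
  rw [← h₁]
  exact (conj_eq_conj _ (last_naturality _ q (hf φ)) h).symm

theorem pad_pad (hf : IsNatural U f) {n m : ℕ} (h : n ≤ m) : pad m (pad n f) = pad n f := by
  funext l
  obtain ⟨φ, q, hφ⟩ := split_take F h l
  change conj _ (tensR (conj _ (tensR _ _)) _) = conj _ _
  rw [← tensR_whiskerRight, ← tensR_tensR, ← conj_trans, ← conj_trans]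
  exact (conj_eq_conj _ (last_naturality _ q (hf φ))
    (by simpa only [Iso.trans_hom, whiskerRightIso_hom, Category.assoc] using hφ)).symm

/-- Coface `j` merges positions `j - 1` and `j`, counted from zero. These lie beyond the `n` factors
on which `f` acts. -/
theorem coface_pad_of_lt (hf : IsNatural U f) {n j : ℕ} (h : n < j) :
    coface j (pad n f) = pad n f := by
  obtain ⟨j, rfl⟩ : ∃ i, j = i + 1 := ⟨j - 1, by omega⟩
  funext l
  obtain ⟨φ, q, hφ⟩ := split_contract_of_le F (Nat.le_of_lt_succ h) l
  change conj _ (conj _ (tensR _ _)) = conj _ (tensR _ _)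
  rw [← conj_trans]
  exact conj_eq_conj _ (last_naturality _ q (hf φ)) hφ

theorem coface_pad_of_le (hf : IsNatural U f) {n j : ℕ} (h : j ≤ n) :
    coface j (pad n f) = pad (n + 1) (coface j f) := by
  funext l
  match j, l with
  | 0, [] =>
    refine (pad_of_length_le hf [] n.zero_le).trans ?_
    have h₁ : pad (n + 1) (coface 0 f) [] = pad (n + 1) f [] := rfl
    rw [h₁, pad_of_length_le hf [] (Nat.zero_le _)]
  | 0, X :: l =>
    change tensL _ (conj _ (tensR _ _)) =
      conj (whiskerLeftIso _ _ ≪≫ (α_ _ _ _).symm) (tensR (tensL _ _) _)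
    rw [← tensR_tensL, conj_trans, ← conj_trans (α_ _ _ _).symm, Iso.symm_self_id, conj_refl,
      tensL_whiskerLeft]
  | j + 1, l =>
    obtain ⟨φ, q, hφ⟩ := split_contract_of_lt F h l
    change conj _ (conj _ (tensR _ _)) = conj _ (tensR (conj _ _) _)
    rw [← tensR_whiskerRight, ← conj_trans, ← conj_trans]
    exact conj_eq_conj _ (last_naturality _ q (hf φ)) hφ

theorem _root_.DavydovYetter.IsNatural.coface (hf : IsNatural U f) (j : ℕ) :
    IsNatural U (coface j f) := by
  intro l l' φ
  match j, l, l', φ with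
  | 0, _, _, .nil => exact hf .nil
  | 0, X :: l, Y :: l', .cons a φ =>
    exact first_naturality (F.map a) (tensorPowMap F φ) (U.naturality a) (hf φ)
  | j + 1, _, _, φ => exact conj_natural (hf (φ.contract j)) (tensorMerge_naturality F j φ)

theorem _root_.DavydovYetter.IsNatural.pad (hf : IsNatural U f) (n : ℕ) :
    IsNatural U (pad n f) := fun φ =>
  conj_natural (last_naturality _ _ (hf (φ.take n))) (tensorSplit_naturality F n φ)

section Comon

variable [ComonObj U]

theorem comul_coassoc :
    comul U ≫ U.obj ◁ comul U = comul U ≫ comul U ▷ U.obj ≫ (α_ U.obj U.obj U.obj).hom := by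
  have h := congrArg Centralizer.Hom.f (ComonObj.comul_assoc U)
  exact h

/-- The comultiplication is a morphism of the centralizer, not only of `D`. This is what makes the
zeroth coface multiplicative and preserve equivariance. -/
theorem comul_braid (X : C) :
    comul U ▷ F.obj X ≫ (α_ U.obj U.obj (F.obj X)).hom ≫ U.obj ◁ (U.β X).hom ≫
      (α_ U.obj (F.obj X) U.obj).inv ≫ (U.β X).hom ▷ U.obj ≫ (α_ (F.obj X) U.obj U.obj).hom =
        (U.β X).hom ≫ F.obj X ◁ comul U := by
  have h := Centralizer.Hom.comm (ComonObj.comul (X := U)) X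
  rw [Centralizer.tensor_β] at h
  simp only [Iso.trans_hom, whiskerLeftIso_hom, whiskerRightIso_hom, Iso.symm_hom] at h
  exact h.symm

/-- The convolution product of families. -/
def mul (f g : Family U) : Family U := fun l => conv (comul U) (f l) (g l)

/-- Equivariance of a family. -/
def IsEquivariant (f : Family U) : Prop :=
  ∀ l : List C, Equivariant (comul U) (braid U l) (f l)

theorem coface_mul (j : ℕ) (f g : Family U) :
    coface j (mul f g) = mul (coface j f) (coface j g) := by
  funext l
  match j, l with
  | 0, [] => rfl
  | 0, X :: l => exact tensL_conv (comul_braid X) _ _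
  | j + 1, l => exact conj_conv _ _ _ _

theorem pad_mul (n : ℕ) (f g : Family U) : pad n (mul f g) = mul (pad n f) (pad n g) := by
  funext l
  change conj _ (tensR (conv _ _ _) _) = conv _ (conj _ _) (conj _ _)
  rw [tensR_conv, conj_conv]

theorem _root_.DavydovYetter.IsNatural.mul (hf : IsNatural U f) (hg : IsNatural U g) :
    IsNatural U (mul f g) := by
  intro l l' φ
  change _ ≫ _ ▷ _ ≫ _ ≫ _ ◁ g l' ≫ f l' = (_ ▷ _ ≫ _ ≫ _ ◁ g l ≫ f l) ≫ _
  rw [← Category.assoc, whisker_exchange, Category.assoc, tensor_whiskerLeft_assoc,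
    Iso.inv_hom_id_assoc, ← MonoidalCategory.whiskerLeft_comp_assoc, hg φ,
    MonoidalCategory.whiskerLeft_comp_assoc, hf φ]
  simp only [Category.assoc]

theorem IsEquivariant.mul (hf : IsEquivariant f) (hg : IsEquivariant g) :
    IsEquivariant (mul f g) := fun l => (hf l).conv comul_coassoc (hg l)

theorem IsEquivariant.pad (hf : IsEquivariant f) (n : ℕ) : IsEquivariant (pad n f) := fun l =>
  ((hf (l.take n)).tensR (braid U (l.drop n))).conj _ (braid_split U n l)

theorem IsEquivariant.coface (hf : IsEquivariant f) (j : ℕ) : IsEquivariant (coface j f) := by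
  intro l
  match j, l with
  | 0, [] => exact hf []
  | 0, X :: l => exact (hf l).tensL (comul_braid X)
  | j + 1, l => exact (hf _).conj _ (braid_merge U j l)

theorem IsEquivariant.interchange (hf : IsEquivariant f) (m : ℕ) (g : Family U) :
    Family.mul (Family.pad m f) (shift m g) = Family.mul (shift m g) (Family.pad m f) := by
  funext l
  -- Both factors are transported along the same splitting of the tuple, so the claim reduces to
  -- interchange for two tensor factors.
  refine (conj_conv _ _ _ _).symm.trans (Eq.trans ?_ (conj_conv _ _ _ _))
  rw [(hf (l.take m)).interchange]

end Comon

end Family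

end FamilyOperations

/-! ### Formal consequences of the cosimplicial identities: Leibniz rule and homotopy -/

section Cosimplicial

variable {k A : Type*} [CommRing k] [AddCommGroup A] [Module k A]

/-- The alternating sum of the first `n` coface operators. -/
def altSum (d : ℕ → A →ₗ[k] A) (n : ℕ) : A →ₗ[k] A :=
  ∑ j ∈ Finset.range n, (-1 : k) ^ j • d j

variable {d : ℕ → A →ₗ[k] A}

theorem altSum_apply (n : ℕ) (x : A) :
    altSum d n x = ∑ j ∈ Finset.range n, (-1 : k) ^ j • d j x := by
  simp [altSum]

theorem altSum_succ (n : ℕ) (x : A) :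
    altSum d (n + 1) x = altSum d n x + (-1 : k) ^ n • d n x := by
  simp [altSum_apply, Finset.sum_range_succ]

theorem sq_neg_one_pow (n : ℕ) : (-1 : k) ^ n * (-1) ^ n = 1 := by
  rw [← mul_pow]; simp

variable (hd : ∀ {i j : ℕ}, i ≤ j → ∀ x, d (j + 1) (d i x) = d i (d j x))
include hd

theorem altSum_altSum (n : ℕ) (x : A) : altSum d (n + 1) (altSum d n x) = 0 := by
  induction n with
  | zero => simp [altSum]
  | succ n ih =>
    -- Here `dₙ₊₁ dⱼ = dⱼ dₙ` for `j < n`. So the mixed terms created by the two new cofaces cancel,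
    -- as do the two copies of `dₙ dₙ x`.
    have h : d (n + 1) (altSum d n x) = altSum d n (d n x) := by
      simp only [altSum_apply, map_sum, map_smul]
      refine Finset.sum_congr rfl fun j hj => ?_
      rw [hd (Finset.mem_range.1 hj).le]
    rw [altSum_succ (n + 1), altSum_succ n x, map_add, map_add, ih, map_smul, map_smul, h,
      altSum_succ, hd le_rfl, smul_add, smul_add, smul_smul, smul_smul, pow_succ]
    module

/-- A power `dᵢᵇ` inserts a block of positions from `i` to `i + b`. A coface below the block shifts
it, one inside lengthens it, and one beyond it passes through with its index lowered by `b`. This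
lemma and the next four record these cases. -/
theorem coface_pow_zero {i m : ℕ} (h : i ≤ m) (x : A) : d i ((d 0 ^ m) x) = (d 0 ^ (m + 1)) x := by
  induction m generalizing i with
  | zero => obtain rfl : i = 0 := by omega
            simp
  | succ m ih =>
    match i with
    | 0 => rw [pow_succ' _ (m + 1)]; rfl
    | i + 1 =>
      rw [pow_succ', Module.End.mul_apply, hd (Nat.zero_le i), ih (by omega), pow_succ' _ (m + 1)]
      rfl

theorem coface_add_pow_zero (j m : ℕ) (x : A) :
    d (j + m) ((d 0 ^ m) x) = (d 0 ^ m) (d j x) := by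
  induction m with
  | zero => rfl
  | succ m ih =>
    rw [pow_succ', Module.End.mul_apply, ← add_assoc, hd (Nat.zero_le _), ih]
    rfl

theorem coface_pow_of_le {i j : ℕ} (h : j ≤ i) (b : ℕ) (x : A) :
    d j ((d i ^ b) x) = (d (i + 1) ^ b) (d j x) := by
  induction b with
  | zero => rfl
  | succ b ih =>
    rw [pow_succ', Module.End.mul_apply, ← hd h, ih, pow_succ', Module.End.mul_apply]

theorem coface_pow_of_mem {i t b : ℕ} (h : t ≤ b) (x : A) :
    d (i + t) ((d i ^ b) x) = (d i ^ (b + 1)) x := by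
  induction b generalizing t with
  | zero => obtain rfl : t = 0 := by omega
            simp
  | succ b ih =>
    match t with
    | 0 => rw [pow_succ' _ (b + 1)]; rfl
    | t + 1 =>
      rw [pow_succ', Module.End.mul_apply, ← add_assoc, hd (Nat.le_add_right _ _),
        ih (by omega), pow_succ' _ (b + 1)]
      rfl

theorem coface_pow_of_lt {i j : ℕ} (h : i ≤ j) (b : ℕ) (x : A) :
    d (j + b) ((d i ^ b) x) = (d i ^ b) (d j x) := by
  induction b with
  | zero => rfl
  | succ b ih =>
    rw [pow_succ', Module.End.mul_apply, ← add_assoc, hd (by omega), ih]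
    rfl

variable {mul : A →ₗ[k] A →ₗ[k] A} (hmul : ∀ j x y, d j (mul x y) = mul (d j x) (d j y))
include hmul

/-- The Leibniz rule for the product `(f, g) ↦ f * d₀ᵐ g`. -/
theorem altSum_mul {m : ℕ} (n : ℕ) {f : A} (hf : ∀ j, m < j → d j f = f) (g : A) :
    altSum d (m + n + 2) (mul f ((d 0 ^ m) g)) =
      mul (altSum d (m + 2) f) ((d 0 ^ (m + 1)) g) +
        (-1 : k) ^ m • mul f ((d 0 ^ m) (altSum d (n + 2) g)) := by
  have h₁ : ∀ j ∈ Finset.range (m + 1), (-1 : k) ^ j • d j (mul f ((d 0 ^ m) g)) =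
      (-1 : k) ^ j • mul (d j f) ((d 0 ^ (m + 1)) g) := fun j hj => by
    rw [hmul, coface_pow_zero hd (Nat.lt_succ_iff.1 (Finset.mem_range.1 hj))]
  have h₂ : ∀ t ∈ Finset.range (n + 1),
      (-1 : k) ^ (m + 1 + t) • d (m + 1 + t) (mul f ((d 0 ^ m) g)) =
        (-1 : k) ^ (m + 1 + t) • mul f ((d 0 ^ m) (d (t + 1) g)) := fun t _ => by
    rw [hmul, hf _ (by omega), show m + 1 + t = t + 1 + m by omega, coface_add_pow_zero hd]
  -- Cofaces up to `m` act on `f` and later ones on `g`. Each differential on the right has one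
  -- extra term, `dₘ₊₁ f = f` here and `d₀ g` in `e₂`; both give `f * d₀ᵐ⁺¹ g`, with opposite signs.
  have e₁ : mul (altSum d (m + 2) f) ((d 0 ^ (m + 1)) g) =
      ∑ j ∈ Finset.range (m + 1), (-1 : k) ^ j • mul (d j f) ((d 0 ^ (m + 1)) g) +
        (-1 : k) ^ (m + 1) • mul f ((d 0 ^ (m + 1)) g) := by
    rw [altSum_succ, hf _ (Nat.lt_succ_self m), altSum_apply]
    simp only [map_add, map_sum, map_smul, LinearMap.add_apply, LinearMap.sum_apply,
      LinearMap.smul_apply]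
  have e₂ : mul f ((d 0 ^ m) (altSum d (n + 2) g)) =
      ∑ t ∈ Finset.range (n + 1), (-1 : k) ^ (t + 1) • mul f ((d 0 ^ m) (d (t + 1) g)) +
        mul f ((d 0 ^ (m + 1)) g) := by
    rw [altSum_apply, Finset.sum_range_succ', pow_zero, one_smul, map_add, map_add, pow_succ,
      Module.End.mul_apply]
    simp only [map_sum, map_smul]
  have e₃ : ∀ t : ℕ, (-1 : k) ^ (m + 1 + t) = (-1) ^ m * (-1) ^ (t + 1) := fun t => by
    rw [← pow_add]; congr 1; omega
  rw [show m + n + 2 = (m + 1) + (n + 1) by omega, altSum_apply, Finset.sum_range_add,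
    Finset.sum_congr rfl h₁, Finset.sum_congr rfl h₂, e₁, e₂]
  simp only [e₃, mul_smul, ← Finset.smul_sum, pow_succ _ m]
  module

/-- Graded commutativity up to homotopy of the product `(f, g) ↦ f * d₀ᵐ g`, modulo a submodule
`V`; the homotopy is `∑ i, ± (dᵢ₊₁ᵇ f) * d₀ⁱ g`. -/
theorem mul_sub_mul_mem {m b : ℕ} {f g : A} (hf : ∀ j, m < j → d j f = f)
    (hg : ∀ j, b + 1 < j → d j g = g) {V : Submodule k A}
    (hfV : ∀ i ≤ m, mul ((d (i + 1) ^ b) (altSum d (m + 2) f)) ((d 0 ^ i) g) ∈ V)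
    (hgV : ∀ i < m, mul ((d (i + 1) ^ (b + 1)) f) ((d 0 ^ i) (altSum d (b + 3) g)) ∈ V) :
    mul f ((d 0 ^ m) g) - (-1 : k) ^ (m * (b + 1)) • mul ((d 0 ^ (b + 1)) f) g -
      altSum d (m + b + 2) (∑ i ∈ Finset.range m,
        (-1 : k) ^ (m * (b + 1) + b + b * i) • mul ((d (i + 1) ^ b) f) ((d 0 ^ i) g)) ∈ V := by
  -- The element `a s i` inserts `g` after `i` factors into `dₛ f`; `R i` is the part `s ≤ i` of the
  -- alternating sum over `s`, while `T i` is the full sum and contains the differential of `f`.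
  -- Likewise `c i` contains the differential of `g`. Both `T` and `c` are negligible modulo `V`.
  set a : ℕ → ℕ → A := fun s i => mul ((d (i + 1) ^ b) (d s f)) ((d 0 ^ i) g) with ha
  set R : ℕ → A := fun i => ∑ j ∈ Finset.range (i + 1), (-1 : k) ^ j • a j i with hR
  set T : ℕ → A := fun i => mul ((d (i + 1) ^ b) (altSum d (m + 2) f)) ((d 0 ^ i) g) with hT
  set c : ℕ → A := fun i => mul ((d (i + 1) ^ (b + 1)) f) ((d 0 ^ i) (altSum d (b + 3) g)) with hc
  have hTa : ∀ i, T i = ∑ s ∈ Finset.range (m + 2), (-1 : k) ^ s • a s i := fun i => by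
    simp [hT, ha, altSum_apply]
  -- The cofaces of one insertion fall into three ranges: those before the inserted block (`h₁`)
  -- give part of `R (i + 1)`, those inside it (`h₂`) the inner terms of `c i`, and those after it
  -- (`h₃`) the part of `T i` above `i + 1`.
  have row : ∀ i ∈ Finset.range m, altSum d (m + b + 2) (mul ((d (i + 1) ^ b) f) ((d 0 ^ i) g)) =
      R (i + 1) - (-1 : k) ^ b • R i + (-1 : k) ^ b • T i + (-1 : k) ^ i • c i := by
    intro i hi
    have := Finset.mem_range.1 hi
    have h₁ : ∀ j ∈ Finset.range (i + 1),
        (-1 : k) ^ j • d j (mul ((d (i + 1) ^ b) f) ((d 0 ^ i) g)) =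
          (-1 : k) ^ j • a j (i + 1) := fun j hj => by
      have hj := Finset.mem_range.1 hj
      rw [hmul, coface_pow_of_le hd hj.le, coface_pow_zero hd (Nat.lt_succ_iff.1 hj)]
    have h₂ : ∀ t ∈ Finset.range (b + 1),
        (-1 : k) ^ (i + 1 + t) • d (i + 1 + t) (mul ((d (i + 1) ^ b) f) ((d 0 ^ i) g)) =
          ((-1 : k) ^ i * (-1) ^ (t + 1)) •
            mul ((d (i + 1) ^ (b + 1)) f) ((d 0 ^ i) (d (t + 1) g)) := fun t ht => by
      rw [hmul, coface_pow_of_mem hd (Nat.lt_succ_iff.1 (Finset.mem_range.1 ht)),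
        show i + 1 + t = t + 1 + i by omega, coface_add_pow_zero hd, pow_add, mul_comm]
    have h₃ : ∀ s ∈ Finset.range (m - i),
        (-1 : k) ^ (i + 1 + (b + 1 + s)) •
            d (i + 1 + (b + 1 + s)) (mul ((d (i + 1) ^ b) f) ((d 0 ^ i) g)) =
          ((-1 : k) ^ b * (-1) ^ (i + 2 + s)) • a (i + 2 + s) i := fun s _ => by
      have e : d (i + 1 + (b + 1 + s)) ((d 0 ^ i) g) = (d 0 ^ i) g := by
        rw [show i + 1 + (b + 1 + s) = b + 2 + s + i by omega, coface_add_pow_zero hd,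
          hg _ (by omega)]
      rw [hmul, e, show i + 1 + (b + 1 + s) = i + 2 + s + b by omega,
        coface_pow_of_lt hd (by omega), pow_add, mul_comm]
    -- The outer terms `d₀ g` and `d_{b+2} g = g` supply the entries that the three ranges miss: the
    -- top term of `R (i + 1)`, and the term of `T i` with `s = i + 1`.
    have hci : c i = a (i + 1) (i + 1) + ∑ t ∈ Finset.range (b + 1), (-1 : k) ^ (t + 1) •
        mul ((d (i + 1) ^ (b + 1)) f) ((d 0 ^ i) (d (t + 1) g)) + (-1 : k) ^ b • a (i + 1) i := by
      simp only [hc, ha]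
      rw [altSum_succ, altSum_apply, Finset.sum_range_succ', hg (b + 2) (by omega), pow_zero,
        one_smul, ← coface_pow_of_le hd le_rfl, pow_succ (d 0) i, Module.End.mul_apply,
        pow_succ' (d (i + 1)), ← Module.End.mul_apply (d (i + 1)), ← pow_succ',
        ← Module.End.mul_apply _ (d (i + 1)), ← pow_succ, pow_add _ b 2, neg_one_sq, mul_one]
      simp only [map_add, map_sum, map_smul]
      abel
    have hTi : T i = R i + (-1 : k) ^ (i + 1) • a (i + 1) i +
        ∑ s ∈ Finset.range (m - i), (-1 : k) ^ (i + 2 + s) • a (i + 2 + s) i := by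
      rw [hTa, show m + 2 = i + 2 + (m - i) by omega, Finset.sum_range_add,
        Finset.sum_range_succ]
    have hRi : R (i + 1) = ∑ j ∈ Finset.range (i + 1), (-1 : k) ^ j • a j (i + 1) +
        (-1 : k) ^ (i + 1) • a (i + 1) (i + 1) := Finset.sum_range_succ _ _
    rw [altSum_apply, show m + b + 2 = i + 1 + (b + 1 + (m - i)) by omega,
      Finset.sum_range_add _ (i + 1), Finset.sum_range_add _ (b + 1), Finset.sum_congr rfl h₁, Finset.sum_congr rfl h₂,
      Finset.sum_congr rfl h₃, hci, hTi, hRi]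
    simp only [mul_smul, ← Finset.smul_sum, pow_succ _ i]
    module
  -- The ends of the telescope are the two products to be compared: `R 0` is this one. The other is
  -- the single term `s = m + 1` missing from `R m`, so `R m` equals it up to sign and `T m`.
  have e₀ : a 0 0 = mul ((d 0 ^ (b + 1)) f) g := by
    simp only [ha, pow_zero, Module.End.one_apply, zero_add]
    rw [← coface_pow_of_le hd le_rfl, ← Module.End.mul_apply, ← pow_succ']
  have em : a (m + 1) m = mul f ((d 0 ^ m) g) := by
    have h : ∀ r, (d (m + 1) ^ r) f = f := fun r => by
      rw [Module.End.pow_apply]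
      exact Function.iterate_fixed (hf _ (Nat.lt_succ_self m)) r
    simp only [ha, hf _ (Nat.lt_succ_self m), h]
  have hRm : R m = T m + (-1 : k) ^ m • mul f ((d 0 ^ m) g) := by
    rw [hTa, Finset.sum_range_succ, em, pow_succ]
    simp only [hR]
    module
  -- The weight `(-1)^{bi}` in the homotopy compensates the sign `(-1)ᵇ` between consecutive `R`.
  -- The prefactor `(-1)^{m(b+1)+b}` normalizes the coefficient of `f * d₀ᵐ g` to one, which is
  -- `hs`.
  have tele : ∀ N, ∑ i ∈ Finset.range N, (-1 : k) ^ (b * i) •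
      ((-1 : k) ^ b • R (i + 1) - R i) = (-1 : k) ^ (b * N) • R N - R 0 := by
    intro N
    induction N with
    | zero => simp
    | succ N ih => rw [Finset.sum_range_succ, ih, mul_add, mul_one, pow_add]; module
  have key : altSum d (m + b + 2) (∑ i ∈ Finset.range m,
      (-1 : k) ^ (m * (b + 1) + b + b * i) • mul ((d (i + 1) ^ b) f) ((d 0 ^ i) g)) =
      (-1 : k) ^ (m * (b + 1)) • ((-1 : k) ^ (b * m) • R m - R 0 + ∑ i ∈ Finset.range m,
        (-1 : k) ^ (b * i) • (T i + (-1 : k) ^ (b + i) • c i)) := by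
    rw [← tele, ← Finset.sum_add_distrib, map_sum, Finset.smul_sum]
    refine Finset.sum_congr rfl fun i hi => ?_
    rw [map_smul, row i hi, pow_add, pow_add, mul_smul, mul_smul, ← smul_add]
    congr 1
    rw [smul_comm]
    congr 1
    simp only [smul_add, smul_sub, smul_smul, sq_neg_one_pow, pow_add, one_smul]
    abel
  have hR0 : R 0 = a 0 0 := by simp [hR]
  have hs : (-1 : k) ^ (m * (b + 1)) * ((-1 : k) ^ (b * m) * (-1) ^ m) = 1 := by
    rw [← pow_add, ← pow_add]
    exact Even.neg_one_pow ⟨m * (b + 1), by ring⟩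
  rw [key, hR0, hRm, e₀]
  have hV : (-1 : k) ^ (m * (b + 1)) • ((-1 : k) ^ (b * m) • T m + ∑ i ∈ Finset.range m,
      (-1 : k) ^ (b * i) • (T i + (-1 : k) ^ (b + i) • c i)) ∈ V :=
    V.smul_mem _ (V.add_mem (V.smul_mem _ (hfV m le_rfl)) (V.sum_mem fun i hi =>
      have hi := Finset.mem_range.1 hi
      V.smul_mem _ (V.add_mem (hfV i hi.le) (V.smul_mem _ (hgV i hi)))))
  convert V.neg_mem hV using 1
  simp only [smul_add, smul_sub, smul_smul, hs, one_smul]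
  abel

end Cosimplicial

/-! ### Linear structure on families and comparison with cochains -/

section LinearFamilies

variable {C : Type u₁} [Category.{v₁} C] [MonoidalCategory C]
variable {D : Type u₂} [Category.{v₂} D] [MonoidalCategory D]
variable {F : C ⥤ D} [F.Monoidal]
variable (U : Centralizer F) (k : Type*) [Field k] [Preadditive D] [MonoidalPreadditive D]
  [Linear k D] [MonoidalLinear k D]

open Family Cochain

/-- The space of natural families. -/
def naturalFamilies : Submodule k (Family U) where
  carrier := {f | IsNatural U f}
  add_mem' {f g} hf hg l l' φ := by
    rw [Pi.add_apply, Pi.add_apply, Preadditive.comp_add, Preadditive.add_comp, hf φ, hg φ]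
  zero_mem' {l l'} φ := by
    rw [Pi.zero_apply, Pi.zero_apply, Limits.comp_zero, Limits.zero_comp]
  smul_mem' c f hf l l' φ := by
    rw [Pi.smul_apply, Pi.smul_apply, Linear.comp_smul, Linear.smul_comp, hf φ]

variable {U} {k}

theorem coface_add (j : ℕ) (f g : Family U) : coface j (f + g) = coface j f + coface j g := by
  funext l
  match j, l with
  | 0, [] => rfl
  | 0, X :: l =>
    change tensL _ (f l + g l) = tensL _ (f l) + tensL _ (g l)
    simp only [tensL, MonoidalPreadditive.whiskerLeft_add, Preadditive.comp_add]
  | j + 1, l =>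
    change conj _ (f _ + g _) = conj _ (f _) + conj _ (g _)
    simp only [conj, Preadditive.comp_add, Preadditive.add_comp]

theorem coface_smul (j : ℕ) (a : k) (f : Family U) : coface j (a • f) = a • coface j f := by
  funext l
  match j, l with
  | 0, [] => rfl
  | 0, X :: l =>
    change tensL (U.β X).hom (a • f l) = a • tensL (U.β X).hom (f l)
    simp only [tensL, MonoidalLinear.whiskerLeft_smul, Linear.comp_smul]
  | j + 1, l =>
    change conj (tensorMerge F j l) (a • f (contract j l)) =
      a • conj (tensorMerge F j l) (f (contract j l))
    simp only [conj, Linear.comp_smul, Linear.smul_comp]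

theorem pad_add (n : ℕ) (f g : Family U) : pad n (f + g) = pad n f + pad n g := by
  funext l
  simp only [pad, conj, tensR, Pi.add_apply, MonoidalPreadditive.add_whiskerRight,
    Preadditive.comp_add, Preadditive.add_comp]

theorem pad_smul (n : ℕ) (a : k) (f : Family U) : pad n (a • f) = a • pad n f := by
  funext l
  simp only [pad, conj, tensR, Pi.smul_apply, MonoidalLinear.smul_whiskerRight,
    Linear.comp_smul, Linear.smul_comp]

variable (U k)

/-- The operators `Family.coface j` on natural families. -/
def cofaceₗ (j : ℕ) : naturalFamilies U k →ₗ[k] naturalFamilies U k where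
  toFun f := ⟨coface j f.1, IsNatural.coface f.2 j⟩
  map_add' f g := Subtype.ext (coface_add j f.1 g.1)
  map_smul' a f := Subtype.ext (coface_smul j a f.1)

/-- The families of the form `f_{X₁, …, Xₙ} ⊗ F Xₙ₊₁ ⊗ ⋯`. -/
def stable (n : ℕ) : Submodule k (naturalFamilies U k) where
  carrier := {f | pad n f.1 = f.1}
  add_mem' {f g} hf hg := (pad_add n f.1 g.1).trans (congrArg₂ (· + ·) hf hg)
  zero_mem' := by
    funext l
    simp [pad, conj, tensR]
  smul_mem' a f hf := (pad_smul n a f.1).trans (congrArg (a • ·) hf)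

/-- The families that vanish on all tuples of length at least `n`. -/
def vanishing (n : ℕ) : Submodule k (naturalFamilies U k) where
  carrier := {f | ∀ l : List C, n ≤ l.length → f.1 l = 0}
  add_mem' {f g} hf hg l hl := by
    change f.1 l + g.1 l = 0
    rw [hf l hl, hg l hl, add_zero]
  zero_mem' _ _ := rfl
  smul_mem' a f hf l hl := by
    change a • f.1 l = 0
    rw [hf l hl, smul_zero]

/-- The part of degree `n` of a family. -/
def restrict (n : ℕ) : naturalFamilies U k →ₗ[k] Cochain U n where
  toFun f := Cochain.of (fun l _ => f.1 l) fun φ _ _ => f.2 φ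
  map_add' _ _ := rfl
  map_smul' _ _ := rfl

variable {U k}

theorem restrict_component (n : ℕ) (f : naturalFamilies U k) (l : List C) (hl : l.length = n) :
    (restrict U k n f).component l hl = f.1 l := rfl

theorem cofaceₗ_comm {i j : ℕ} (h : i ≤ j) (f : naturalFamilies U k) :
    cofaceₗ U k (j + 1) (cofaceₗ U k i f) = cofaceₗ U k i (cofaceₗ U k j f) :=
  Subtype.ext (coface_comm f.2 h)

theorem cofaceₗ_of_stable {n j : ℕ} (h : n < j) {f : naturalFamilies U k} (hf : f ∈ stable U k n) :
    cofaceₗ U k j f = f := by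
  have hf : pad n f.1 = f.1 := hf
  apply Subtype.ext
  change coface j f.1 = f.1
  rw [← hf, coface_pad_of_lt f.2 h]

theorem stable_mono {n m : ℕ} (h : n ≤ m) : stable U k n ≤ stable U k m := fun f hf => by
  have hf : pad n f.1 = f.1 := hf
  change pad m f.1 = f.1
  rw [← hf, pad_pad f.2 h]

theorem cofaceₗ_mem_stable {n : ℕ} (j : ℕ) {f : naturalFamilies U k} (hf : f ∈ stable U k n) :
    cofaceₗ U k j f ∈ stable U k (n + 1) := by
  rcases Nat.lt_or_ge n j with h | h
  · rw [cofaceₗ_of_stable h hf]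
    exact stable_mono n.le_succ hf
  · have hf : pad n f.1 = f.1 := hf
    change pad (n + 1) (coface j f.1) = coface j f.1
    rw [← coface_pad_of_le f.2 h, hf]

theorem cofaceₗ_pow_mem_stable {n : ℕ} (j r : ℕ) {f : naturalFamilies U k}
    (hf : f ∈ stable U k n) : (cofaceₗ U k j ^ r) f ∈ stable U k (n + r) := by
  induction r with
  | zero => exact hf
  | succ r ih => rw [pow_succ']; exact cofaceₗ_mem_stable j ih

theorem altSum_mem_stable {n : ℕ} (r : ℕ) {f : naturalFamilies U k} (hf : f ∈ stable U k n) :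
    altSum (cofaceₗ U k) r f ∈ stable U k (n + 1) := by
  rw [altSum_apply]
  exact Submodule.sum_mem _ fun j _ => Submodule.smul_mem _ _ (cofaceₗ_mem_stable j hf)

theorem vanishing_anti {n m : ℕ} (h : n ≤ m) : vanishing U k n ≤ vanishing U k m :=
  fun _ hf l hl => hf l (h.trans hl)

theorem le_length_contract : ∀ (j : ℕ) (l : List C), l.length ≤ (contract j l).length + 1
  | 0, [] => by simp [contract]
  | 0, [_] => by simp [contract]
  | 0, _ :: _ :: _ => by simp [contract]
  | _ + 1, [] => by simp [contract]
  | j + 1, _ :: l => by simpa [contract] using le_length_contract j l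

theorem cofaceₗ_mem_vanishing {n : ℕ} (j : ℕ) {f : naturalFamilies U k}
    (hf : f ∈ vanishing U k n) : cofaceₗ U k j f ∈ vanishing U k (n + 1) := by
  intro l hl
  match j, l with
  | 0, [] => simp at hl
  | 0, X :: l =>
    change tensL _ (f.1 l) = 0
    rw [hf l (by simpa using hl)]
    simp [tensL]
  | j + 1, l =>
    change conj _ (f.1 _) = 0
    rw [hf _ (by have := le_length_contract j l; omega)]
    simp [conj]

theorem cofaceₗ_pow_mem_vanishing {n : ℕ} (j r : ℕ) {f : naturalFamilies U k}
    (hf : f ∈ vanishing U k n) : (cofaceₗ U k j ^ r) f ∈ vanishing U k (n + r) := by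
  induction r with
  | zero => exact hf
  | succ r ih => rw [pow_succ']; exact cofaceₗ_mem_vanishing j ih

/-- On tuples of length at least `n`, a stable family is determined by its degree `n` part. -/
theorem mem_vanishing_of_restrict_eq_zero {n : ℕ} {f : naturalFamilies U k}
    (hf : f ∈ stable U k n) (h : restrict U k n f = 0) : f ∈ vanishing U k n := by
  intro l hl
  have hf : pad n f.1 = f.1 := hf
  have h' : f.1 (l.take n) = 0 := by
    rw [← restrict_component n f (l.take n) (by simpa using hl), h]; rfl
  rw [← hf]
  simp [pad, conj, tensR, h']

theorem restrict_of_mem_vanishing {n : ℕ} {f : naturalFamilies U k} (h : f ∈ vanishing U k n) :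
    restrict U k n f = 0 :=
  Cochain.ext' fun l hl => h l hl.ge

/-- Extension by zero to tuples of other lengths. -/
def extend {n : ℕ} (f : Cochain U n) : Family U := fun l =>
  if h : l.length = n then f.component l h else 0

theorem extend_of_length {n : ℕ} (f : Cochain U n) {l : List C} (h : l.length = n) :
    extend f l = f.component l h := dif_pos h

theorem isNatural_extend {n : ℕ} (f : Cochain U n) : IsNatural U (extend f) := by
  intro l l' φ
  have hl := φ.length_eq
  by_cases h : l.length = n
  · rw [extend_of_length f h, extend_of_length f (hl.symm.trans h)]
    exact f.component_naturality φ _ _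
  · rw [extend, extend, dif_neg h, dif_neg (hl ▸ h), Limits.comp_zero, Limits.zero_comp]

/-- The family `f_{X₁, …, Xₙ} ⊗ F Xₙ₊₁ ⊗ ⋯` defined by a cochain. -/
def stabilize (k : Type*) [Field k] [Linear k D] [MonoidalLinear k D] {n : ℕ} (f : Cochain U n) :
    naturalFamilies U k :=
  ⟨pad n (extend f), IsNatural.pad (isNatural_extend f) n⟩

theorem stabilize_mem {n : ℕ} (f : Cochain U n) : stabilize k f ∈ stable U k n :=
  pad_pad (isNatural_extend f) le_rfl

theorem restrict_stabilize {n : ℕ} (f : Cochain U n) : restrict U k n (stabilize k f) = f :=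
  Cochain.ext' fun l hl =>
    (pad_of_length_le (isNatural_extend f) l hl.le).trans (extend_of_length f hl)

theorem restrict_cofaceₗ_zero (n : ℕ) (f : naturalFamilies U k) :
    restrict U k (n + 1) (cofaceₗ U k 0 f) = dFirst U (restrict U k n f) :=
  Cochain.ext' fun l hl => by
    have h : coface 0 f.1 = shift 1 f.1 := by rw [shift_succ, shift_zero]
    exact congrFun h l

theorem restrict_cofaceₗ_succ {n : ℕ} (i : Fin n) (f : naturalFamilies U k) :
    restrict U k (n + 1) (cofaceₗ U k (i + 1) f) = dMiddle U (restrict U k n f) i := rfl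

theorem restrict_of_stable {n : ℕ} {f : naturalFamilies U k} (hf : f ∈ stable U k n) :
    restrict U k (n + 1) f = dLast U (restrict U k n f) :=
  Cochain.ext' fun l _ => (congrFun hf l).symm

/-- There are `n + 2` cofaces. The zeroth is the braiding term, the next `n` are the contractions,
and coface `n + 1` fixes `f`, whose degree `n + 1` part is `f ⊗ F Xₙ` by stability. -/
theorem delta_restrict {n : ℕ} {f : naturalFamilies U k} (hf : f ∈ stable U k n) :
    delta U k n (restrict U k n f) = restrict U k (n + 1) (altSum (cofaceₗ U k) (n + 2) f) := by
  rw [altSum_succ, altSum_apply, Finset.sum_range_succ', cofaceₗ_of_stable n.lt_succ_self hf,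
    Finset.sum_range]
  simp only [map_add, map_sum, map_smul, restrict_cofaceₗ_zero, restrict_of_stable hf,
    restrict_cofaceₗ_succ, pow_zero, one_smul]
  change dFirst U _ + _ + _ = _
  abel

theorem delta_delta (n : ℕ) (f : Cochain U n) : delta U k (n + 1) (delta U k n f) = 0 := by
  have hf := stabilize_mem (k := k) f
  rw [← restrict_stabilize (k := k) f, delta_restrict hf,
    delta_restrict (altSum_mem_stable _ hf), altSum_altSum cofaceₗ_comm, map_zero]

/-- The cocycle condition controls tuples of length `n + 1` and, by stability, longer ones, but says
nothing about shorter tuples. This is why the homotopy is stated modulo a submodule. -/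
theorem altSum_mem_vanishing {n : ℕ} {f : naturalFamilies U k} (hf : f ∈ stable U k n)
    (h : delta U k n (restrict U k n f) = 0) :
    altSum (cofaceₗ U k) (n + 2) f ∈ vanishing U k (n + 1) :=
  mem_vanishing_of_restrict_eq_zero (altSum_mem_stable _ hf) (by rw [← delta_restrict hf, h])

theorem cofaceₗ_zero_pow_val (m : ℕ) (f : naturalFamilies U k) :
    ((cofaceₗ U k 0 ^ m) f).1 = shift m f.1 := by
  induction m with
  | zero => exact (shift_zero f.1).symm
  | succ m ih =>
    rw [pow_succ', shift_succ, ← ih]; rfl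

/-! ### Equivariant families and the cup product -/

variable [ComonObj U]

variable (U k) in
/-- The equivariant natural families. -/
def equivariantFamilies : Submodule k (naturalFamilies U k) where
  carrier := {f | IsEquivariant f.1}
  add_mem' {f g} hf hg l := by
    change Equivariant _ _ (f.1 l + g.1 l)
    have hf := hf l
    have hg := hg l
    simp only [Equivariant] at hf hg ⊢
    simp only [MonoidalPreadditive.whiskerLeft_add, MonoidalPreadditive.add_whiskerRight,
      Preadditive.comp_add, Preadditive.add_comp, hf, hg]
  zero_mem' l := by
    change Equivariant _ _ 0
    simp [Equivariant]
  smul_mem' c f hf l := by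
    change Equivariant _ _ (c • f.1 l)
    have hf := hf l
    simp only [Equivariant] at hf ⊢
    simp only [MonoidalLinear.whiskerLeft_smul, MonoidalLinear.smul_whiskerRight,
      Linear.comp_smul, Linear.smul_comp, hf]

theorem restrict_mem_equivariant (n : ℕ) {f : naturalFamilies U k}
    (hf : f ∈ equivariantFamilies U k) : restrict U k n f ∈ equivariant U k n :=
  fun l _ => hf l

theorem stabilize_mem_equivariant {n : ℕ} {f : Cochain U n} (hf : f ∈ equivariant U k n) :
    stabilize k f ∈ equivariantFamilies U k := by
  refine IsEquivariant.pad (fun l => ?_) n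
  by_cases h : l.length = n
  · rw [extend_of_length f h]
    exact hf l h
  · rw [extend, dif_neg h]
    simp [Equivariant]

theorem cofaceₗ_mem_equivariant (j : ℕ) {f : naturalFamilies U k}
    (hf : f ∈ equivariantFamilies U k) : cofaceₗ U k j f ∈ equivariantFamilies U k :=
  IsEquivariant.coface hf j

theorem cofaceₗ_pow_mem_equivariant (j r : ℕ) {f : naturalFamilies U k}
    (hf : f ∈ equivariantFamilies U k) : (cofaceₗ U k j ^ r) f ∈ equivariantFamilies U k := by
  induction r with
  | zero => exact hf
  | succ r ih => rw [pow_succ']; exact cofaceₗ_mem_equivariant j ih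

theorem delta_mem_equivariant (n : ℕ) (f : Cochain U n) (hf : f ∈ equivariant U k n) :
    delta U k n f ∈ equivariant U k (n + 1) := by
  rw [← restrict_stabilize (k := k) f, delta_restrict (stabilize_mem f), altSum_apply]
  exact restrict_mem_equivariant _ (Submodule.sum_mem _ fun j _ => Submodule.smul_mem _ _
    (cofaceₗ_mem_equivariant j (stabilize_mem_equivariant hf)))

variable (U k) in
/-- The convolution product of natural families. -/
def mulₗ : naturalFamilies U k →ₗ[k] naturalFamilies U k →ₗ[k] naturalFamilies U k :=
  LinearMap.mk₂ k (fun f g => ⟨mul f.1 g.1, IsNatural.mul f.2 g.2⟩)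
    (fun f f' g => Subtype.ext <| funext fun l => by
      change conv _ (f.1 l + f'.1 l) (g.1 l) = conv _ (f.1 l) (g.1 l) + conv _ (f'.1 l) (g.1 l)
      simp only [conv, Preadditive.comp_add])
    (fun a f g => Subtype.ext <| funext fun l => by
      change conv _ (a • f.1 l) (g.1 l) = a • conv _ (f.1 l) (g.1 l)
      simp only [conv, Linear.comp_smul])
    (fun f g g' => Subtype.ext <| funext fun l => by
      change conv _ (f.1 l) (g.1 l + g'.1 l) = conv _ (f.1 l) (g.1 l) + conv _ (f.1 l) (g'.1 l)
      simp only [conv, MonoidalPreadditive.whiskerLeft_add, Preadditive.comp_add,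
        Preadditive.add_comp])
    (fun a f g => Subtype.ext <| funext fun l => by
      change conv _ (f.1 l) (a • g.1 l) = a • conv _ (f.1 l) (g.1 l)
      simp only [conv, MonoidalLinear.whiskerLeft_smul, Linear.comp_smul, Linear.smul_comp])

theorem cofaceₗ_mulₗ (j : ℕ) (f g : naturalFamilies U k) :
    cofaceₗ U k j (mulₗ U k f g) = mulₗ U k (cofaceₗ U k j f) (cofaceₗ U k j g) :=
  Subtype.ext (coface_mul j f.1 g.1)

theorem mulₗ_mem_stable {n : ℕ} {f g : naturalFamilies U k} (hf : f ∈ stable U k n)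
    (hg : g ∈ stable U k n) : mulₗ U k f g ∈ stable U k n :=
  (pad_mul n f.1 g.1).trans (congrArg₂ Family.mul hf hg)

theorem mulₗ_mem_vanishing_left {n : ℕ} {f : naturalFamilies U k} (hf : f ∈ vanishing U k n)
    (g : naturalFamilies U k) : mulₗ U k f g ∈ vanishing U k n := fun l hl => by
  change conv _ (f.1 l) (g.1 l) = 0
  simp [hf l hl, conv]

theorem mulₗ_mem_vanishing_right {n : ℕ} (f : naturalFamilies U k) {g : naturalFamilies U k}
    (hg : g ∈ vanishing U k n) : mulₗ U k f g ∈ vanishing U k n := fun l hl => by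
  change conv _ (f.1 l) (g.1 l) = 0
  simp [hg l hl, conv]

theorem mulₗ_mem_equivariant {f g : naturalFamilies U k} (hf : f ∈ equivariantFamilies U k)
    (hg : g ∈ equivariantFamilies U k) : mulₗ U k f g ∈ equivariantFamilies U k :=
  IsEquivariant.mul hf hg

/-- The step where equivariance yields commutativity: `f` uses only the first `m` factors, and `d₀ᵐ
g` acts only on those after them. -/
theorem mulₗ_interchange {m : ℕ} {f : naturalFamilies U k} (hf : f ∈ stable U k m)
    (hf' : f ∈ equivariantFamilies U k) (g : naturalFamilies U k) :
    mulₗ U k f ((cofaceₗ U k 0 ^ m) g) = mulₗ U k ((cofaceₗ U k 0 ^ m) g) f := by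
  have h := IsEquivariant.interchange hf' m g.1
  rw [show pad m f.1 = f.1 from hf, ← cofaceₗ_zero_pow_val] at h
  exact Subtype.ext h

theorem cup_restrict {m n p : ℕ} (h : m + n = p) {f : naturalFamilies U k}
    (hf : f ∈ stable U k m) (g : naturalFamilies U k) :
    cup U h (restrict U k m f) (restrict U k n g) =
      restrict U k p (mulₗ U k f ((cofaceₗ U k 0 ^ m) g)) :=
  Cochain.ext' fun l hl => by
    rw [restrict_component]
    change _ = conv (comul U) (f.1 l) (((cofaceₗ U k 0 ^ m) g).1 l)
    have hf : pad m f.1 = f.1 := hf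
    rw [cofaceₗ_zero_pow_val, ← hf]
    refine Eq.trans ?_ (conj_conv _ _ _ _)
    rw [conv_tensR_tensL]
    rfl

theorem cup_stabilize {m n p : ℕ} (h : m + n = p) (f : Cochain U m) (g : Cochain U n) :
    cup U h f g =
      restrict U k p (mulₗ U k (stabilize k f) ((cofaceₗ U k 0 ^ m) (stabilize k g))) := by
  rw [← cup_restrict h (stabilize_mem f), restrict_stabilize, restrict_stabilize]

theorem cup_component {m n p : ℕ} (h : m + n = p) (f : Cochain U m) (g : Cochain U n)
    (l : List C) (hl : l.length = p) : (cup U h f g).component l hl = viaSplit U m l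
      (comul U ▷ (tensorPow F (l.take m) ⊗ tensorPow F (l.drop m)) ≫ (α_ _ _ _).hom ≫
        U.obj ◁ ((α_ _ _ _).inv ≫ braid U (l.take m) ▷ tensorPow F (l.drop m) ≫ (α_ _ _ _).hom) ≫
          (α_ _ _ _).inv ≫ (f.component (l.take m) (length_take_of h hl) ⊗ₘ
            g.component (l.drop m) (length_drop_of h hl))) := rfl

variable (U k) in
/-- The cup product as a bilinear map. -/
def cupₗ {m n p : ℕ} (h : m + n = p) : Cochain U m →ₗ[k] Cochain U n →ₗ[k] Cochain U p :=
  LinearMap.mk₂ k (cup U h)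
    (fun f f' g => Cochain.ext' fun l hl => by
      rw [component_add]
      simp only [cup_component, viaSplit, component_add, MonoidalPreadditive.add_tensor,
        Preadditive.comp_add, Preadditive.add_comp])
    (fun a f g => Cochain.ext' fun l hl => by
      rw [component_smul]
      simp only [cup_component, viaSplit, component_smul, MonoidalCategory.tensorHom_def,
        MonoidalLinear.smul_whiskerRight, Linear.comp_smul, Linear.smul_comp])
    (fun f g g' => Cochain.ext' fun l hl => by
      rw [component_add]
      simp only [cup_component, viaSplit, component_add, MonoidalPreadditive.tensor_add,
        Preadditive.comp_add, Preadditive.add_comp])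
    (fun a f g => Cochain.ext' fun l hl => by
      rw [component_smul]
      simp only [cup_component, viaSplit, component_smul, MonoidalCategory.tensorHom_def,
        MonoidalLinear.whiskerLeft_smul, Linear.comp_smul, Linear.smul_comp])

theorem cupₗ_apply {m n p : ℕ} (h : m + n = p) (f : Cochain U m) (g : Cochain U n) :
    cupₗ U k h f g = cup U h f g := rfl

/-- The Leibniz rule. -/
theorem delta_cup {m n p : ℕ} (h : m + n = p) (f : Cochain U m) (g : Cochain U n) :
    delta U k p (cup U h f g) =
      cup U (show m + 1 + n = p + 1 by omega) (delta U k m f) g +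
        (-1 : k) ^ m • cup U (show m + (n + 1) = p + 1 by omega) f (delta U k n g) := by
  have hf := stabilize_mem (k := k) f
  have hg := stabilize_mem (k := k) g
  -- Stability in the total degree is what lets the differential of the product be computed by
  -- cofaces.
  have hfg : mulₗ U k (stabilize k f) ((cofaceₗ U k 0 ^ m) (stabilize k g)) ∈ stable U k p :=
    mulₗ_mem_stable (stable_mono (by omega) hf)
      (stable_mono (by omega) (cofaceₗ_pow_mem_stable 0 m hg))
  subst h
  rw [cup_stabilize (k := k), delta_restrict hfg,
    altSum_mul cofaceₗ_comm cofaceₗ_mulₗ n (fun j hj => cofaceₗ_of_stable hj hf), map_add,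
    map_smul, ← cup_restrict (n := n) (by omega) (altSum_mem_stable _ hf),
    ← cup_restrict (n := n + 1) (by omega) hf, ← delta_restrict hf, ← delta_restrict hg,
    restrict_stabilize, restrict_stabilize]

theorem cup_mem_equivariant {m n p : ℕ} (h : m + n = p) {f : Cochain U m} {g : Cochain U n}
    (hf : f ∈ equivariant U k m) (hg : g ∈ equivariant U k n) :
    cup U h f g ∈ equivariant U k p := by
  rw [cup_stabilize (k := k)]
  exact restrict_mem_equivariant _ (mulₗ_mem_equivariant (stabilize_mem_equivariant hf)
    (cofaceₗ_pow_mem_equivariant 0 m (stabilize_mem_equivariant hg)))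

theorem cup_mem_cocycles {m n p : ℕ} (h : m + n = p) {f : Cochain U m} {g : Cochain U n}
    (hf : f ∈ cocycles U k m) (hg : g ∈ cocycles U k n) : cup U h f g ∈ cocycles U k p := by
  refine ⟨cup_mem_equivariant h hf.1 hg.1, ?_⟩
  have hf' : delta U k m f = 0 := hf.2
  have hg' : delta U k n g = 0 := hg.2
  change delta U k p _ = 0
  rw [delta_cup, hf', hg', ← cupₗ_apply (k := k), ← cupₗ_apply (k := k),
    map_zero, map_zero, smul_zero, LinearMap.zero_apply, add_zero]

theorem cup_mem_coboundaries_left {m n p : ℕ} (h : m + n = p) {f : Cochain U m}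
    {g : Cochain U n} (hf : f ∈ coboundaries U k m) (hg : g ∈ cocycles U k n) :
    cup U h f g ∈ coboundaries U k p := by
  have hg' : delta U k n g = 0 := hg.2
  match m, p, h, f, hf with
  | 0, p, h, f, hf =>
    obtain rfl : f = 0 := (Submodule.mem_bot k).1 hf
    rw [← cupₗ_apply (k := k), map_zero]
    exact Submodule.zero_mem _
  | m + 1, 0, h, _, _ => omega
  | m + 1, p + 1, h, _, ⟨f, hf, rfl⟩ =>
    refine ⟨cup U (show m + n = p by omega) f g, cup_mem_equivariant _ hf hg.1, ?_⟩
    rw [delta_cup, hg', ← cupₗ_apply (k := k) (f := f), map_zero, smul_zero, add_zero]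

theorem cup_mem_coboundaries_right {m n p : ℕ} (h : m + n = p) {f : Cochain U m}
    {g : Cochain U n} (hf : f ∈ cocycles U k m) (hg : g ∈ coboundaries U k n) :
    cup U h f g ∈ coboundaries U k p := by
  have hf' : delta U k m f = 0 := hf.2
  match n, p, h, g, hg with
  | 0, p, h, g, hg =>
    obtain rfl : g = 0 := (Submodule.mem_bot k).1 hg
    rw [← cupₗ_apply (k := k), map_zero]
    exact Submodule.zero_mem _
  | n + 1, 0, h, _, _ => omega
  | n + 1, p + 1, h, _, ⟨g, hg, rfl⟩ =>
    -- The sign cancels the one in the Leibniz rule, where the term with `δ f = 0` drops out.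
    refine ⟨(-1 : k) ^ m • cup U (show m + n = p by omega) f g,
      Submodule.smul_mem _ _ (cup_mem_equivariant _ hf.1 hg), ?_⟩
    rw [map_smul, delta_cup, hf', ← cupₗ_apply (k := k) (g := g), map_zero,
      LinearMap.zero_apply, zero_add, smul_smul, sq_neg_one_pow, one_smul]

/-- The second degree must be positive because inserting a cochain of degree `b + 1` into one slot
of `f` uses the power `b` of a coface. For `m = 0` the homotopy is an empty sum. -/
theorem cup_sub_cup_mem_of_pos {m b p : ℕ} (h : m + (b + 1) = p) {f : Cochain U m}
    {g : Cochain U (b + 1)} (hf : f ∈ cocycles U k m) (hg : g ∈ cocycles U k (b + 1)) :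
    cup U h f g - (-1 : k) ^ (m * (b + 1)) • cup U ((Nat.add_comm _ _).trans h) g f ∈
      coboundaries U k p := by
  obtain ⟨p, rfl⟩ : ∃ q, p = q + 1 := ⟨m + b, by omega⟩
  obtain rfl : m + b = p := by omega
  have sf := stabilize_mem (k := k) f
  have sg := stabilize_mem (k := k) g
  have ef := stabilize_mem_equivariant hf.1
  have eg := stabilize_mem_equivariant hg.1
  have vf := altSum_mem_vanishing sf (by rw [restrict_stabilize]; exact hf.2)
  have vg := altSum_mem_vanishing sg (by rw [restrict_stabilize]; exact hg.2)
  have key := mul_sub_mul_mem (k := k) cofaceₗ_comm cofaceₗ_mulₗ (m := m) (b := b)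
    (fun j hj => cofaceₗ_of_stable hj sf) (fun j hj => cofaceₗ_of_stable hj sg)
    -- The error terms vanish on tuples of the total degree: the differential of `f` vanishes from
    -- length `m + 1` on and is raised by `b`; that of `g` vanishes from length `b + 2` on and is
    -- raised by `i < m`.
    (V := vanishing U k (m + b + 1))
    (fun i _ => mulₗ_mem_vanishing_left
      (vanishing_anti (by omega) (cofaceₗ_pow_mem_vanishing (i + 1) b vf)) _)
    (fun i hi => mulₗ_mem_vanishing_right _
      (vanishing_anti (by omega) (cofaceₗ_pow_mem_vanishing 0 i vg)))
  -- Interchange for `g` turns `(d₀ᵇ⁺¹ f) * g` into `g * d₀ᵇ⁺¹ f`, the family of `g ∪ f`.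
  rw [← mulₗ_interchange sg eg] at key
  have key := restrict_of_mem_vanishing key
  rw [map_sub, map_sub, map_smul, ← cup_stabilize h, ← cup_stabilize ((Nat.add_comm _ _).trans h),
    ← delta_restrict, sub_eq_zero] at key
  · rw [key]
    refine ⟨_, restrict_mem_equivariant _ ?_, rfl⟩
    exact Submodule.sum_mem _ fun i _ => Submodule.smul_mem _ _ (mulₗ_mem_equivariant
      (cofaceₗ_pow_mem_equivariant _ _ ef) (cofaceₗ_pow_mem_equivariant _ _ eg))
  · refine Submodule.sum_mem _ fun i hi => Submodule.smul_mem _ _ ?_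
    have hi := Finset.mem_range.1 hi
    exact mulₗ_mem_stable (cofaceₗ_pow_mem_stable _ _ sf)
      (stable_mono (by omega) (cofaceₗ_pow_mem_stable 0 i sg))

theorem cup_sub_cup_mem_coboundaries {m n p : ℕ} (h : m + n = p) {f : Cochain U m}
    {g : Cochain U n} (hf : f ∈ cocycles U k m) (hg : g ∈ cocycles U k n) :
    cup U h f g - (-1 : k) ^ (m * n) • cup U ((Nat.add_comm _ _).trans h) g f ∈
      coboundaries U k p := by
  match m, n, f, g, hf, hg with
  | m, n + 1, f, g, hf, hg => exact cup_sub_cup_mem_of_pos h hf hg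
  | m + 1, 0, f, g, hf, hg =>
    -- With one degree zero the sign is `1`, so exchanging the two cocycles only negates the
    -- difference.
    have := Submodule.neg_mem _ (cup_sub_cup_mem_of_pos ((Nat.add_comm _ _).trans h) hg hf)
    simpa using this
  | 0, 0, f, g, hf, hg =>
    -- In bidegree `(0, 0)` no homotopy is needed: with `m = 0` interchange already says that the
    -- two products are equal.
    have h' := mulₗ_interchange (stabilize_mem f) (stabilize_mem_equivariant hf.1)
      (stabilize k g)
    have h₁ : cup U h f g = cup U ((Nat.add_comm _ _).trans h) g f := by
      rw [cup_stabilize (k := k), h', cup_stabilize (k := k)]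
      rfl
    rw [h₁]
    simp

/-! ### Descent to cohomology -/

variable (U k) in
/-- The product on cohomology. -/
def cohomologyCup {m n p : ℕ} (h : m + n = p) :
    Cohomology U k m →ₗ[k] Cohomology U k n →ₗ[k] Cohomology U k p :=
  let Φ : cocycles U k m →ₗ[k] cocycles U k n →ₗ[k] Cohomology U k p :=
    LinearMap.mk₂ k
      (fun f g => cohomologyClass U k p ⟨cup U h f.1 g.1, cup_mem_cocycles h f.2 g.2⟩)
      (fun f f' g => by
        rw [← map_add]
        exact congrArg _ (Subtype.ext ((cupₗ U k h).map_add₂ f.1 f'.1 g.1)))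
      (fun a f g => by
        rw [← map_smul]
        exact congrArg _ (Subtype.ext ((cupₗ U k h).map_smul₂ a f.1 g.1)))
      (fun f g g' => by
        rw [← map_add]
        exact congrArg _ (Subtype.ext ((cupₗ U k h f.1).map_add g.1 g'.1)))
      (fun a f g => by
        rw [← map_smul]
        exact congrArg _ (Subtype.ext ((cupₗ U k h f.1).map_smul a g.1)))
  -- The second variable descends first, against cocycles `f`; the first then descends, tested on
  -- representatives of the second.
  Submodule.liftQ _ (LinearMap.flip (Submodule.liftQ _ Φ.flip fun g hg =>
      LinearMap.ext fun f => (Submodule.Quotient.mk_eq_zero _).2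
        (cup_mem_coboundaries_right h f.2 hg)))
    fun f hf => LinearMap.ext fun g => by
      obtain ⟨g, rfl⟩ := Submodule.Quotient.mk_surjective _ g
      exact (Submodule.Quotient.mk_eq_zero _).2 (cup_mem_coboundaries_left h hf g.2)

theorem cohomologyCup_class {m n p : ℕ} (h : m + n = p) (f : cocycles U k m)
    (g : cocycles U k n) :
    cohomologyCup U k h (cohomologyClass U k m f) (cohomologyClass U k n g) =
      cohomologyClass U k p ⟨cup U h f.1 g.1, cup_mem_cocycles h f.2 g.2⟩ := rfl

theorem cohomologyCup_comm {m n p : ℕ} (h : m + n = p) (f : Cohomology U k m)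
    (g : Cohomology U k n) :
    cohomologyCup U k h f g =
      (-1 : k) ^ (m * n) • cohomologyCup U k ((Nat.add_comm n m).trans h) g f := by
  obtain ⟨f, rfl⟩ := Submodule.Quotient.mk_surjective _ f
  obtain ⟨g, rfl⟩ := Submodule.Quotient.mk_surjective _ g
  exact (Submodule.Quotient.eq _).2 (cup_sub_cup_mem_coboundaries h f.2 g.2)

end LinearFamilies

end DavydovYetter

theorem corollary3p11
    {k : Type*} [Field k]
    {C : Type*} [Category C] [Abelian C] [Linear k C] [MonoidalCategory C]
    [MonoidalPreadditive C] [MonoidalLinear k C]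
    {D : Type*} [Category D] [Abelian D] [Linear k D] [MonoidalCategory D]
    [MonoidalPreadditive D] [MonoidalLinear k D]
    (F : C ⥤ D) [F.Monoidal] [F.Additive] [F.Linear k]
    (U : Centralizer F) [ComonObj U] :
    -- the equivariant cochains form a subcomplex of the Davydov-Yetter complex
    (∀ (n : ℕ) (f : Cochain U n), delta U k (n + 1) (delta U k n f) = 0) ∧
    (∀ (n : ℕ) (f : Cochain U n), f ∈ equivariant U k n →
      delta U k n f ∈ equivariant U k (n + 1)) ∧
    -- the cup product of cochains induces a product on its cohomology
    ∃ cupH : ∀ {m n p : ℕ}, m + n = p →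
        Cohomology U k m →ₗ[k] Cohomology U k n →ₗ[k] Cohomology U k p,
      (∀ (m n p : ℕ) (h : m + n = p) (f : cocycles U k m) (g : cocycles U k n),
        ∃ hfg : cup U h f.1 g.1 ∈ cocycles U k p,
          cupH h (cohomologyClass U k m f) (cohomologyClass U k n g) =
            cohomologyClass U k p ⟨cup U h f.1 g.1, hfg⟩) ∧
      -- and this product is graded commutative
      ∀ (m n p : ℕ) (h : m + n = p) (f : Cohomology U k m) (g : Cohomology U k n),
        cupH h f g = (-1 : k) ^ (m * n) • cupH ((Nat.add_comm n m).trans h) g f :=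
  ⟨delta_delta, delta_mem_equivariant, cohomologyCup U k,
    fun _ _ _ h f g => ⟨cup_mem_cocycles h f.2 g.2, cohomologyCup_class h f g⟩,
    fun _ _ _ h f g => cohomologyCup_comm h f g⟩
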